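/- **Setting.** Let $\Sigma=\{0,1\}$ and $\Gamma=[0,1]$, and let $\lambda:\Sigma\times\Gamma\to[0,\infty]$ be a loss function, with the convention $0\cdot\infty=0$. The game $(\Sigma,\Gamma,\lambda)$ is *regular* if $\lambda$ is continuous; $\lambda(b,\cdot)$ is convex for each $b\in\Sigma$; some $\gamma\in\Gamma$ has $\lambda(0,\gamma),\lambda(1,\gamma)<\infty$; and whenever $\lambda(b,\gamma)=\infty$ there are $\gamma_i\to\gamma$ with $\lambda(b,\gamma_i)<\infty$ for all $i$. A *strategy* $\wp$ consists of one function $\wp^i:\Sigma^i\to\Gamma$ for every $i\in\mathbb N$, and its loss on $w\in\Sigma^n$ is $\mathrm{Loss}(w,\wp)=\sum_{i=0}^{n-1}\lambda(w_i,\wp^i(w_0\dots w_{i-1}))$. Let $P$ be a probability measure on $\Sigma^{\mathbb N}$ that is stationary and ergodic for the left shift, and write $P(w)$ for the probability of the set of sequences with prefix $w$. Put $$H_n=\inf_{\wp}\sum_{w\in\Sigma^n}P(w)\,\mathrm{Loss}(w,\wp),\qquad H=\lim_{n\to\infty}\frac{H_n}{n}$$ ($H$ is the *generalized entropy*). Let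 $\hat P$ be the two-sided extension of $P$, that is, the unique shift-invariant measure on $\Sigma^{\mathbb Z}$ whose image on the coordinates $0,1,2,\dots$ is $P$. The game is *strongly regular* (with respect to $P$) if it is regular and there is a continuous map $s:[0,1]\to\Gamma$ such that 1. for every $p\in[0,1]$, $s(p)$ minimizes $\gamma\mapsto p\,\lambda(0,\gamma)+(1-p)\,\lambda(1,\gamma)$ over $\Gamma$; 2. with $$g_k(\omega)=\lambda\bigl(\omega_0,s(\hat P\{\omega_0=0\mid\omega_{-k},\dots,\omega_{-1}\})\bigr),\qquad g(\omega)=\lambda\bigl(\omega_0,s(\hat P\{\omega_0=0\mid\omega_{i},\,i<0\})\bigr),$$ the functions $G_N=\sup_{k\ge N}|g_k-g|$, $N\ge1$, are uniformly integrable: $$\lim_{\alpha\to\infty}\sup_{N\ge1}\int_{\{G_N>\alpha\}}G_N\,d\hat P=0 .$$ **Theorem.** Let the game be strongly regular with respect to the stationary ergodic distribution $P$. Then the limit $H$ exists and is finite. Moreover, if for every $n$ the strategy $\wp_n$ attains $H_n$, i.e. $\sum_{w\in\Sigma^n}P(w)\,\mathrm{Loss}(w,\wp_n)=H_n$ (in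 particular, if all the $\wp_n$ are one and the same strategy $\wp$ that attains every $H_n$), then $$\lim_{n\to\infty}\frac{\mathrm{Loss}(\omega_0\dots\omega_{n-1},\wp_n)}{n}=H\qquad\text{for }P\text{-almost every }\omega .$$ -/

import Mathlib

open MeasureTheory Filter Topology
open scoped ENNReal NNReal unitInterval

namespace PredictionGame

/-! Outcomes are bits, the bit `0` being `false`; the prediction space is `[0, 1]`;
losses take values in `[0, ∞]`, where `0 * ∞ = 0`. -/

/-- A regular game, given by its loss function `lam b γ`: it is continuous on `{0,1} × [0,1]`,
convex in the prediction, some prediction has finite loss for both outcomes, and predictions of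
infinite loss are limits of predictions of finite loss. -/
structure IsRegular (lam : Bool → I → ℝ≥0∞) : Prop where
  continuous : Continuous fun q : Bool × I => lam q.1 q.2
  convex : ∀ (b : Bool) (x y z : I) (s t : ℝ≥0), s + t = 1 →
    (z : ℝ) = s * x + t * y → lam b z ≤ s * lam b x + t * lam b y
  exists_finite : ∃ γ : I, ∀ b : Bool, lam b γ < ∞
  approx_finite : ∀ (b : Bool) (γ : I), lam b γ = ∞ →
    ∃ u : ℕ → I, Tendsto u atTop (𝓝 γ) ∧ ∀ i, lam b (u i) < ∞

/-- A prediction strategy: one function on the words of length `i` for every `i`. -/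
abbrev Strategy : Type := (i : ℕ) → (Fin i → Bool) → I

/-- The cumulative loss of a strategy on a finite word. -/
noncomputable def loss (lam : Bool → I → ℝ≥0∞) {n : ℕ} (w : Fin n → Bool) (S : Strategy) : ℝ≥0∞ :=
  ∑ i : Fin n, lam (w i) (S i fun j => w (Fin.castLE i.isLt.le j))

/-- The first `n` outcomes `ω_0 … ω_{n-1}`. -/
def pre (n : ℕ) (ω : ℕ → Bool) : Fin n → Bool := fun i => ω i

/-- The set of sequences with the prefix `w`. -/
def cyl {n : ℕ} (w : Fin n → Bool) : Set (ℕ → Bool) := {ω | pre n ω = w}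

/-- `∑_{w ∈ Σ^n} P(w) Loss(w, S)`. -/
noncomputable def expectedLoss (lam : Bool → I → ℝ≥0∞) (P : Measure (ℕ → Bool)) (n : ℕ)
    (S : Strategy) : ℝ≥0∞ :=
  ∑ w : Fin n → Bool, P (cyl w) * loss lam w S

/-- The `n`-step generalized entropy `H_n`. -/
noncomputable def stepEntropy (lam : Bool → I → ℝ≥0∞) (P : Measure (ℕ → Bool)) (n : ℕ) : ℝ≥0∞ :=
  ⨅ S : Strategy, expectedLoss lam P n S

/-- The generalized entropy `H = lim H_n / n`. -/
noncomputable def entropy (lam : Bool → I → ℝ≥0∞) (P : Measure (ℕ → Bool)) : ℝ≥0∞ :=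
  limUnder atTop fun n : ℕ => stepEntropy lam P n / n

/-- The left shift on one-sided sequences. -/
def shift (ω : ℕ → Bool) : ℕ → Bool := fun n => ω (n + 1)

/-- The left shift on two-sided sequences. -/
def shiftZ (ω : ℤ → Bool) : ℤ → Bool := fun i => ω (i + 1)

/-- The restriction of a two-sided sequence to the coordinates `0, 1, 2, …`. -/
def restrictNat (ω : ℤ → Bool) : ℕ → Bool := fun n => ω n

/-- `Q` is the two-sided (natural) extension of the stationary distribution `P`: it is
shift-invariant, and its image on the nonnegative coordinates is `P`. -/
structure IsTwoSidedExtension (P : Measure (ℕ → Bool)) (Q : Measure (ℤ → Bool)) : Prop where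
  invariant : MeasurePreserving shiftZ Q Q
  restrict : MeasurePreserving restrictNat Q P

lemma continuous_shift : Continuous shift := by unfold shift; fun_prop

lemma continuous_shiftZ : Continuous shiftZ := by unfold shiftZ; fun_prop

lemma continuous_restrictNat : Continuous restrictNat := by unfold restrictNat; fun_prop

/-- The sequence `ω` placed so that it starts at position `-k`. -/
def place (k : ℕ) (ω : ℕ → Bool) : ℤ → Bool := fun i => ω (i + k).toNat

lemma continuous_place (k : ℕ) : Continuous (place k) := by unfold place; fun_prop

theorem exists_isTwoSidedExtension (P : Measure (ℕ → Bool)) [IsProbabilityMeasure P]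
    (hP : MeasurePreserving shift P P) : ∃ Q, IsTwoSidedExtension P Q := by
  let P' : ProbabilityMeasure (ℕ → Bool) := ⟨P, inferInstance⟩
  let R : ℕ → ProbabilityMeasure (ℤ → Bool) := fun k =>
    P'.map (continuous_place k).measurable.aemeasurable
  let U : Filter ℕ := (hyperfilter ℕ : Filter ℕ)
  have hU : U ≤ atTop := by
    rw [← Nat.cofinite_eq_atTop]; exact hyperfilter_le_cofinite
  obtain ⟨Q, -, hQ⟩ := isCompact_univ.ultrafilter_le_nhds ((hyperfilter ℕ).map R) (by simp)
  have hQ' : Tendsto R U (𝓝 Q) := hQ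
  have hiter : ∀ k, MeasurePreserving (fun ω : ℕ → Bool => fun n => ω (n + k)) P P := by
    intro k
    induction k with
    | zero => exact MeasurePreserving.id P
    | succ k ih =>
      have := ih.comp hP
      exact this
  refine ⟨Q, ⟨continuous_shiftZ.measurable, ?_⟩, ⟨continuous_restrictNat.measurable, ?_⟩⟩
  · have hmap : ∀ k, (R k).map continuous_shiftZ.measurable.aemeasurable = R (k + 1) := by
      intro k
      apply Subtype.ext
      show Measure.map shiftZ (Measure.map (place k) P) = Measure.map (place (k + 1)) P
      rw [Measure.map_map continuous_shiftZ.measurable (continuous_place k).measurable]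
      congr 1
      funext ω i
      show ω (i + 1 + k).toNat = ω (i + (k + 1 : ℕ)).toNat
      congr 2
      push_cast; ring
    have h1 : Tendsto (fun k => R (k + 1)) U
        (𝓝 (Q.map continuous_shiftZ.measurable.aemeasurable)) := by
      simp_rw [← hmap]
      exact ProbabilityMeasure.tendsto_map_of_tendsto_of_continuous R Q hQ' continuous_shiftZ
    have h2 : Tendsto (fun k => R (k + 1)) U (𝓝 Q) := by
      rw [ProbabilityMeasure.tendsto_iff_forall_integral_tendsto] at hQ' ⊢
      intro f
      have hd : Tendsto (fun k => ∫ ω, (f (place (k + 1) ω) - f (place k (shift ω))) ∂P) U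
          (𝓝 (∫ _, (0 : ℝ) ∂P)) := by
        refine Tendsto.mono_left ?_ hU
        refine tendsto_integral_of_dominated_convergence (fun _ => 2 * ‖f‖) ?_
          (integrable_const _) ?_ ?_
        · intro k
          exact ((f.continuous.comp (continuous_place _)).sub
            (f.continuous.comp ((continuous_place _).comp
              continuous_shift))).aestronglyMeasurable
        · intro k
          refine ae_of_all _ fun ω => ?_
          calc _ ≤ ‖f (place (k + 1) ω)‖ + ‖f (place k (shift ω))‖ := norm_sub_le _ _
            _ ≤ _ := by linarith [f.norm_coe_le_norm (place (k + 1) ω),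
                          f.norm_coe_le_norm (place k (shift ω))]
        · refine ae_of_all _ fun ω => ?_
          have huc : UniformContinuous f :=
            CompactSpace.uniformContinuous_of_continuous f.continuous
          have hz : Tendsto (fun k => (place (k + 1) ω, place k (shift ω))) atTop
              (uniformity (ℤ → Bool)) := by
            rw [Pi.uniformity, tendsto_iInf]
            intro i
            rw [tendsto_comap_iff]
            intro V hV
            refine mem_map.2 ((eventually_ge_atTop i.natAbs).mono fun k hk => ?_)
            have : place (k + 1) ω i = place k (shift ω) i := by
              show ω (i + (k + 1 : ℕ)).toNat = ω ((i + k).toNat + 1)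
              congr 1; omega
            show (place (k + 1) ω i, place k (shift ω) i) ∈ V
            rw [this]
            exact refl_mem_uniformity hV
          have h4 := Tendsto.comp huc hz
          rw [Metric.tendsto_nhds]
          intro ε hε
          filter_upwards [h4 (Metric.dist_mem_uniformity hε)] with k hk
          simpa [Real.dist_eq] using hk
      have hint : ∀ k, ∫ ω, (f (place (k + 1) ω) - f (place k (shift ω))) ∂P =
          ∫ x, f x ∂(R (k + 1) : Measure (ℤ → Bool)) - ∫ x, f x ∂(R k : Measure (ℤ → Bool)) := by
        intro k
        have e1 : ∫ x, f x ∂(R (k + 1) : Measure (ℤ → Bool)) = ∫ ω, f (place (k + 1) ω) ∂P :=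
          integral_map (continuous_place _).measurable.aemeasurable
            f.continuous.aestronglyMeasurable
        have e2 : ∫ x, f x ∂(R k : Measure (ℤ → Bool)) = ∫ ω, f (place k ω) ∂P :=
          integral_map (continuous_place _).measurable.aemeasurable
            f.continuous.aestronglyMeasurable
        have e3 : ∫ ω, f (place k (shift ω)) ∂P = ∫ ω, f (place k ω) ∂P := by
          conv_rhs => rw [← hP.map_eq]
          exact (integral_map hP.measurable.aemeasurable
            (f.continuous.comp (continuous_place k)).aestronglyMeasurable).symm
        rw [e1, e2, ← e3]
        refine integral_sub ?_ ?_
        · exact (f.compContinuous ⟨_, continuous_place (k + 1)⟩).integrable P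
        · exact (f.compContinuous ⟨_, (continuous_place k).comp continuous_shift⟩).integrable P
      have := (hd.congr hint).add (hQ' f)
      simpa using this
    have := tendsto_nhds_unique h1 h2
    exact congrArg Subtype.val this
  · have hmap : ∀ k, (R k).map continuous_restrictNat.measurable.aemeasurable = P' := by
      intro k
      apply Subtype.ext
      show Measure.map restrictNat (Measure.map (place k) P) = P
      rw [Measure.map_map continuous_restrictNat.measurable (continuous_place k).measurable]
      have he : restrictNat ∘ place k = fun ω : ℕ → Bool => fun n => ω (n + k) := by
        funext ω n
        show ω ((n : ℤ) + k).toNat = ω (n + k)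
        congr 1
      rw [he, (hiter k).map_eq]
    have h1 := ProbabilityMeasure.tendsto_map_of_tendsto_of_continuous R Q hQ'
      continuous_restrictNat
    simp_rw [hmap] at h1
    have : Q.map continuous_restrictNat.measurable.aemeasurable = P' :=
      tendsto_nhds_unique h1 tendsto_const_nhds
    exact congrArg Subtype.val this

theorem IsTwoSidedExtension.unique {P : Measure (ℕ → Bool)} [IsProbabilityMeasure P]
    {Q Q' : Measure (ℤ → Bool)} (h : IsTwoSidedExtension P Q) (h' : IsTwoSidedExtension P Q') :
    Q = Q' := by
  have key : ∀ {Q : Measure (ℤ → Bool)}, IsTwoSidedExtension P Q → ∀ m : ℕ,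
      MeasurePreserving (fun ω : ℤ → Bool => fun n : ℕ => ω (n - m)) Q P := by
    intro Q h m
    have hm : Measurable (fun ω : ℤ → Bool => fun n : ℕ => ω (n - m)) := by fun_prop
    refine ⟨hm, ?_⟩
    have hit : MeasurePreserving (fun ω : ℤ → Bool => fun i => ω (i + m)) Q Q := by
      induction m with
      | zero =>
        have := MeasurePreserving.id Q
        convert this using 1
        funext ω i
        simp
      | succ k ih =>
        have := (ih (by fun_prop)).comp h.invariant
        convert this using 1
        funext ω i
        show ω (i + (k + 1 : ℕ)) = ω (i + k + 1)
        congr 1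
        push_cast; ring
    rw [← h.restrict.map_eq]
    conv_lhs => rw [← hit.map_eq]
    rw [Measure.map_map hm hit.measurable]
    congr 1
    funext ω n
    show ω (n - m + m) = ω n
    congr 1; ring
  have hprob : IsProbabilityMeasure Q := by
    constructor
    simpa using h.restrict.measure_preimage MeasurableSet.univ.nullMeasurableSet
  refine ext_of_generate_finite (measurableCylinders fun _ : ℤ => Bool)
    generateFrom_measurableCylinders.symm isPiSystem_measurableCylinders ?_ ?_
  · intro s hs
    obtain ⟨J, S, hS, rfl⟩ := (mem_measurableCylinders s).1 hs
    obtain ⟨m, hm⟩ : ∃ m : ℕ, ∀ j ∈ J, -(m : ℤ) ≤ j := by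
      refine ⟨J.sup Int.natAbs, fun j hj => ?_⟩
      have := Finset.le_sup (f := Int.natAbs) hj
      omega
    have hme : MeasurableSet {η : ℕ → Bool | (fun j : J => η ((j : ℤ) + m).toNat) ∈ S} := by
      have : Measurable (fun η : ℕ → Bool => fun j : J => η ((j : ℤ) + m).toNat) := by fun_prop
      exact this hS
    have hpre : cylinder J S = (fun ω : ℤ → Bool => fun n : ℕ => ω (n - m)) ⁻¹'
        {η : ℕ → Bool | (fun j : J => η ((j : ℤ) + m).toNat) ∈ S} := by
      ext ω
      rw [mem_cylinder]
      show _ ↔ (fun j : J => ω ((((j : ℤ) + m).toNat : ℤ) - m)) ∈ S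
      have : (fun j : J => ω ((((j : ℤ) + m).toNat : ℤ) - m)) = J.restrict ω := by
        funext j
        have := hm j j.2
        show ω _ = ω j
        congr 1; omega
      rw [this]
    rw [hpre, (key h m).measure_preimage hme.nullMeasurableSet,
      (key h' m).measure_preimage hme.nullMeasurableSet]
  · have e1 := h.restrict.measure_preimage MeasurableSet.univ.nullMeasurableSet
    have e2 := h'.restrict.measure_preimage MeasurableSet.univ.nullMeasurableSet
    simpa using e1.trans e2.symm

/-- The two-sided extension of a stationary distribution: it exists and is unique by the two facts
above (and the value is `0` if `P` is not stationary). -/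
noncomputable def twoSided (P : Measure (ℕ → Bool)) : Measure (ℤ → Bool) :=
  open Classical in if h : ∃ Q, IsTwoSidedExtension P Q then h.choose else 0

theorem isTwoSidedExtension_twoSided (P : Measure (ℕ → Bool)) [IsProbabilityMeasure P]
    (hP : MeasurePreserving shift P P) : IsTwoSidedExtension P (twoSided P) := by
  have h := exists_isTwoSidedExtension P hP
  rw [twoSided, dif_pos h]
  exact h.choose_spec

/-- The `σ`-algebra generated by the coordinates `ω_i`, `i ∈ J`. -/
abbrev coordAlgebra (J : Set ℤ) : MeasurableSpace (ℤ → Bool) :=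
  ⨆ i ∈ J, MeasurableSpace.comap (fun ω : ℤ → Bool => ω i) inferInstance

/-- The conditional probability `Q{ω_0 = 0 | (ω_i)_{i ∈ J}}`, as a number in `[0, 1]`
(the projection to `[0, 1]` changes the conditional expectation on a null set only). -/
noncomputable def condProb (Q : Measure (ℤ → Bool)) (J : Set ℤ) (ω : ℤ → Bool) : I :=
  Set.projIcc 0 1 zero_le_one
    ((Q[Set.indicator {η : ℤ → Bool | η 0 = false} (fun _ => (1 : ℝ)) | coordAlgebra J]) ω)

/-- `s p` is a prediction of least expected loss when the bit `0` has probability `p`,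
for every `p`. -/
def IsOptimalMap (lam : Bool → I → ℝ≥0∞) (s : I → I) : Prop :=
  ∀ p γ : I,
    ENNReal.ofReal p * lam false (s p) + ENNReal.ofReal (1 - p) * lam true (s p) ≤
      ENNReal.ofReal p * lam false γ + ENNReal.ofReal (1 - p) * lam true γ

/-- `g_k(ω) = λ(ω_0, s(Q{0 | ω_{-k} … ω_{-1}}))`. -/
noncomputable def gk (lam : Bool → I → ℝ≥0∞) (Q : Measure (ℤ → Bool)) (s : I → I) (k : ℕ)
    (ω : ℤ → Bool) : ℝ≥0∞ :=
  lam (ω 0) (s (condProb Q (Set.Ico (-(k : ℤ)) 0) ω))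

/-- `g(ω) = λ(ω_0, s(Q{0 | … ω_{-2} ω_{-1}}))`. -/
noncomputable def gLim (lam : Bool → I → ℝ≥0∞) (Q : Measure (ℤ → Bool)) (s : I → I)
    (ω : ℤ → Bool) : ℝ≥0∞ :=
  lam (ω 0) (s (condProb Q (Set.Iio 0) ω))

/-- `G_N = sup_{k ≥ N} |g_k - g|`; in `[0, ∞]` the distance `|a - b|` is the sum of the two
truncated differences. -/
noncomputable def gSup (lam : Bool → I → ℝ≥0∞) (Q : Measure (ℤ → Bool)) (s : I → I) (N : ℕ)
    (ω : ℤ → Bool) : ℝ≥0∞ :=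
  ⨆ k ≥ N, ((gk lam Q s k ω - gLim lam Q s ω) + (gLim lam Q s ω - gk lam Q s k ω))

/-- Uniform integrability of a sequence `f_1, f_2, …` of nonnegative functions:
`lim_{α → ∞} sup_{n ≥ 1} ∫ f_n 1[f_n > α] = 0`. -/
def UnifIntegrableSeq {Ω : Type*} [MeasurableSpace Ω] (Q : Measure Ω) (f : ℕ → Ω → ℝ≥0∞) : Prop :=
  Tendsto (fun α : ℝ≥0 => ⨆ n ≥ 1, ∫⁻ ω in {ω | (α : ℝ≥0∞) < f n ω}, f n ω ∂Q) atTop (𝓝 0)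

/-- The game with loss function `lam` is strongly regular with respect to the stationary
distribution `P`: it is regular, the optimal prediction can be chosen as a continuous function `s`
of the conditional probability of `0`, and `(G_N)_{N ≥ 1}` is uniformly integrable. -/
def IsStronglyRegular (lam : Bool → I → ℝ≥0∞) (P : Measure (ℕ → Bool)) : Prop :=
  IsRegular lam ∧ ∃ s : I → I, Continuous s ∧ IsOptimalMap lam s ∧
    UnifIntegrableSeq (twoSided P) (gSup lam (twoSided P) s)

end PredictionGame

/-! The expected loss splits over times and past words into conditional risks, so predicting `s p`
from the conditional probability `p` of the next bit is optimal after every word; this one strategy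
attains all `H_n` at once (`stepEntropy_eq_sum`). Viewed on two-sided sequences, its loss at time
`k` is `g_k` evaluated at the `k`-th shift of `ω`, and the increment of `H_n` at time `k` is the
expectation of `g_k`.

By Lévy's upward theorem and the continuity of `s` and `lam`, `g_k → g` almost surely. The distances
are dominated by `G_N`, which decreases in `N`; uniform integrability enters only through the
integrability of the `G_N`. Dominated convergence and Cesàro means then give `H = ∫ g`, and
Breiman's form of the ergodic theorem (`tendsto_sum_iterate_div`) gives the almost sure convergence
of the average loss, once ergodicity is carried to the two-sided extension.

Any other strategy attaining `H_n` makes a risk-minimizing prediction after each word of positive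
probability of length less than `n`. Continuity of `s` forces all minimizers for a given `0 < p < 1`
to have the same losses on both bits (`IsRegular.eq_of_risk_eq`), so such a strategy almost surely
loses exactly what the canonical one does. -/

namespace PredictionGame

/-! ### The pointwise ergodic theorem -/

section Birkhoff

variable {α : Type*}

/-- The maximum of the Birkhoff sums of lengths `1, …, n + 1`. -/
noncomputable def maxSum (T : α → α) (f : α → ℝ) : ℕ → α → ℝ
  | 0 => f
  | n + 1 => fun x => f x + max 0 (maxSum T f n (T x))

lemma maxSum_le_succ (T : α → α) (f : α → ℝ) (n : ℕ) (x : α) :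
    maxSum T f n x ≤ maxSum T f (n + 1) x := by
  induction n generalizing x with
  | zero => simp [maxSum]
  | succ n ih =>
    show f x + _ ≤ f x + _
    gcongr
    exact ih _

lemma maxSum_monotone (T : α → α) (f : α → ℝ) (x : α) : Monotone fun n => maxSum T f n x :=
  monotone_nat_of_le_succ fun n => maxSum_le_succ T f n x

lemma birkhoffSum_le_maxSum (T : α → α) (f : α → ℝ) (n : ℕ) (x : α) :
    birkhoffSum T f (n + 1) x ≤ maxSum T f n x := by
  induction n generalizing x with
  | zero => simp [maxSum]
  | succ n ih =>
    rw [birkhoffSum_succ']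
    show _ ≤ f x + _
    gcongr
    exact (ih _).trans (le_max_right _ _)

/-- The recursion changes the value at `T x` only by truncation at `0` and the finite number `f x`.
This makes boundedness an invariant event, to which ergodicity applies. -/
lemma bddAbove_maxSum_comp_iff (T : α → α) (f : α → ℝ) (x : α) :
    BddAbove (Set.range fun n => maxSum T f n (T x)) ↔
      BddAbove (Set.range fun n => maxSum T f n x) := by
  constructor
  · rintro ⟨C, hC⟩
    refine ⟨f x + max 0 C, ?_⟩
    rintro _ ⟨n, rfl⟩
    refine (maxSum_le_succ T f n x).trans ?_
    show f x + _ ≤ _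
    gcongr
    exact hC ⟨n, rfl⟩
  · rintro ⟨C, hC⟩
    refine ⟨C - f x, ?_⟩
    rintro _ ⟨n, rfl⟩
    have h : f x + max 0 (maxSum T f n (T x)) ≤ C := hC ⟨n + 1, rfl⟩
    have := le_max_right 0 (maxSum T f n (T x))
    show maxSum T f n (T x) ≤ _
    linarith

variable [MeasurableSpace α] {μ : Measure α} {T : α → α} {f : α → ℝ}

lemma measurable_maxSum (hT : Measurable T) (hf : Measurable f) (n : ℕ) :
    Measurable (maxSum T f n) := by
  induction n with
  | zero => exact hf
  | succ n ih => exact hf.add (measurable_const.max (ih.comp hT))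

lemma integrable_maxSum (hT : MeasurePreserving T μ μ) (hf : Integrable f μ) (n : ℕ) :
    Integrable (maxSum T f n) μ := by
  induction n with
  | zero => exact hf
  | succ n ih =>
    have h : Integrable (fun x => maxSum T f n (T x)) μ := hT.integrable_comp_of_integrable ih
    exact hf.add ((integrable_zero _ _ _).sup h)

/-- If the mean of `f` is negative, then its Birkhoff sums are almost surely bounded above. -/
theorem ae_bddAbove_birkhoffSum [IsProbabilityMeasure μ] (hT : Ergodic T μ) (hfm : Measurable f)
    (hf : Integrable f μ) (hneg : ∫ x, f x ∂μ < 0) :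
    ∀ᵐ x ∂μ, BddAbove (Set.range fun n => birkhoffSum T f n x) := by
  have hB : MeasurableSet {x | BddAbove (Set.range fun n => maxSum T f n x)} :=
    measurableSet_bddAbove_range fun n => measurable_maxSum hT.measurable hfm n
  have hinv : T ⁻¹' {x | BddAbove (Set.range fun n => maxSum T f n x)} =
      {x | BddAbove (Set.range fun n => maxSum T f n x)} := by
    ext x
    exact bddAbove_maxSum_comp_iff T f x
  have key : ∀ᵐ x ∂μ, BddAbove (Set.range fun n => maxSum T f n x) := by
    rcases hT.toPreErgodic.ae_mem_or_ae_notMem hB hinv with h | h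
    · exact h
    -- Were the maxima almost surely unbounded, `maxSum (n + 1) - maxSum n ∘ T` would tend to `f`.
    -- Its integral is nonnegative by invariance and monotonicity in `n`, contradicting the negative
    -- mean.
    exfalso
    have hcomp : ∀ n, Integrable (fun x => maxSum T f n (T x)) μ := fun n =>
      hT.toMeasurePreserving.integrable_comp_of_integrable
        (integrable_maxSum hT.toMeasurePreserving hf n)
    have hlim : Tendsto (fun n => ∫ x, (maxSum T f (n + 1) x - maxSum T f n (T x)) ∂μ) atTop
        (𝓝 (∫ x, f x ∂μ)) := by
      -- The difference is `f x` plus the negative part of `maxSum n (T x)`, and the latter is at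
      -- most `|f (T x)|` because `maxSum n ≥ maxSum 0 = f`.
      refine tendsto_integral_of_dominated_convergence (fun x => ‖f x‖ + ‖f (T x)‖) ?_ ?_ ?_ ?_
      · intro n
        exact ((measurable_maxSum hT.measurable hfm _).sub
          ((measurable_maxSum hT.measurable hfm _).comp hT.measurable)).aestronglyMeasurable
      · exact hf.norm.add (hcomp 0).norm
      · intro n
        refine ae_of_all _ fun x => ?_
        have h0 : f (T x) ≤ maxSum T f n (T x) := maxSum_monotone T f (T x) (Nat.zero_le n)
        show |f x + max 0 (maxSum T f n (T x)) - maxSum T f n (T x)| ≤ |f x| + |f (T x)|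
        rcases le_total 0 (maxSum T f n (T x)) with h1 | h1
        · rw [max_eq_right h1, add_sub_cancel_right]
          linarith [abs_nonneg (f (T x))]
        · rw [max_eq_left h1, add_zero]
          refine (abs_sub _ _).trans ?_
          have : |maxSum T f n (T x)| ≤ |f (T x)| := by
            rw [abs_of_nonpos h1, abs_of_nonpos (h0.trans h1)]
            linarith
          linarith
      · filter_upwards [h] with x hx
        have hx' : ¬ BddAbove (Set.range fun n => maxSum T f n (T x)) := by
          rwa [bddAbove_maxSum_comp_iff]
        rw [not_bddAbove_iff] at hx'
        obtain ⟨_, ⟨N, rfl⟩, hN⟩ := hx' 0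
        refine tendsto_const_nhds.congr' ?_
        filter_upwards [eventually_ge_atTop N] with n hn
        have : 0 ≤ maxSum T f n (T x) := hN.le.trans (maxSum_monotone T f (T x) hn)
        show f x = f x + max 0 (maxSum T f n (T x)) - maxSum T f n (T x)
        rw [max_eq_right this, add_sub_cancel_right]
    have hnn : ∀ n, 0 ≤ ∫ x, (maxSum T f (n + 1) x - maxSum T f n (T x)) ∂μ := by
      intro n
      have hi := integrable_maxSum hT.toMeasurePreserving hf
      have he : ∫ x, maxSum T f n (T x) ∂μ = ∫ x, maxSum T f n x ∂μ := by
        conv_rhs => rw [← hT.map_eq]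
        exact (integral_map hT.measurable.aemeasurable
          (measurable_maxSum hT.measurable hfm n).aestronglyMeasurable).symm
      rw [integral_sub (hi _) (hcomp n), he, sub_nonneg]
      exact integral_mono (hi _) (hi _) fun x => maxSum_le_succ T f n x
    exact absurd (ge_of_tendsto' hlim hnn) (not_le.2 hneg)
  filter_upwards [key] with x ⟨C, hC⟩
  refine ⟨max 0 C, ?_⟩
  rintro _ ⟨n, rfl⟩
  cases n with
  | zero => simp
  | succ n => exact (birkhoffSum_le_maxSum T f n x).trans ((hC ⟨n, rfl⟩).trans (le_max_right _ _))

/-- For `∫ f < d < c` the sums of `f - d` stay below some `C`, so the averages of `f` are at most `d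
+ C / n`. -/
lemma ae_eventually_birkhoffSum_le [IsProbabilityMeasure μ] (hT : Ergodic T μ)
    (hfm : Measurable f) (hf : Integrable f μ) {c : ℝ} (hc : ∫ x, f x ∂μ < c) :
    ∀ᵐ x ∂μ, ∀ᶠ n : ℕ in atTop, birkhoffSum T f n x / n ≤ c := by
  obtain ⟨d, hd, hdc⟩ := exists_between hc
  have h := ae_bddAbove_birkhoffSum (f := fun x => f x - d) hT (hfm.sub_const d)
    (hf.sub (integrable_const d)) (by
      rw [integral_sub hf (integrable_const d)]
      simpa using hd)
  filter_upwards [h] with x ⟨C, hC⟩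
  have hlim : Tendsto (fun n : ℕ => C / n) atTop (𝓝 0) := tendsto_const_div_atTop_nhds_zero_nat C
  filter_upwards [hlim.eventually_lt_const (sub_pos.2 hdc), eventually_gt_atTop 0] with n hn hn0
  have hn0' : (0 : ℝ) < n := by exact_mod_cast hn0
  have h1 : birkhoffSum T (fun x => f x - d) n x ≤ C := hC ⟨n, rfl⟩
  have h2 : birkhoffSum T (fun x => f x - d) n x = birkhoffSum T f n x - n * d := by
    simp [birkhoffSum, Finset.sum_sub_distrib]
  rw [h2] at h1
  rw [div_lt_iff₀ hn0'] at hn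
  rw [div_le_iff₀ hn0']
  linarith

/-- Birkhoff's pointwise ergodic theorem for ergodic transformations. -/
theorem tendsto_birkhoffSum_div [IsProbabilityMeasure μ] (hT : Ergodic T μ)
    (hfm : Measurable f) (hf : Integrable f μ) :
    ∀ᵐ x ∂μ, Tendsto (fun n : ℕ => birkhoffSum T f n x / n) atTop (𝓝 (∫ x, f x ∂μ)) := by
  have hub : ∀ᵐ x ∂μ, ∀ k : ℕ, ∀ᶠ n : ℕ in atTop,
      birkhoffSum T f n x / n ≤ ∫ x, f x ∂μ + 1 / (k + 1 : ℝ) := by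
    rw [ae_all_iff]
    intro k
    exact ae_eventually_birkhoffSum_le hT hfm hf (lt_add_of_pos_right _ Nat.one_div_pos_of_nat)
  have hlb : ∀ᵐ x ∂μ, ∀ k : ℕ, ∀ᶠ n : ℕ in atTop,
      birkhoffSum T (fun x => -f x) n x / n ≤ -∫ x, f x ∂μ + 1 / (k + 1 : ℝ) := by
    rw [ae_all_iff]
    intro k
    refine ae_eventually_birkhoffSum_le hT hfm.neg hf.neg ?_
    rw [integral_neg']
    exact lt_add_of_pos_right _ Nat.one_div_pos_of_nat
  filter_upwards [hub, hlb] with x hu hl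
  rw [tendsto_order]
  constructor
  · intro a ha
    obtain ⟨k, hk⟩ := exists_nat_one_div_lt (sub_pos.2 ha)
    filter_upwards [hl k] with n hn
    have : birkhoffSum T (fun x => -f x) n x = -birkhoffSum T f n x := by simp [birkhoffSum]
    rw [this, neg_div] at hn
    linarith
  · intro a ha
    obtain ⟨k, hk⟩ := exists_nat_one_div_lt (sub_pos.2 ha)
    filter_upwards [hu k] with n hn
    linarith

end Birkhoff

/-- The Breiman–Maker ergodic theorem: averages along the orbit of a sequence of functions `u k`
which converges to `v` and whose distance from `v` is dominated by an integrable function. -/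
theorem tendsto_sum_iterate_div {α : Type*} [MeasurableSpace α] {μ : Measure α}
    [IsProbabilityMeasure μ] {T : α → α} (hT : Ergodic T μ) {u : ℕ → α → ℝ} {v : α → ℝ}
    {G : ℕ → α → ℝ} (hvm : Measurable v) (hv : Integrable v μ) (hGm : ∀ N, Measurable (G N))
    (hG : ∀ N ≥ 1, Integrable (G N) μ) (hG1 : ∀ N ≥ 1, ∀ᵐ x ∂μ, ‖G N x‖ ≤ G 1 x)
    (hG0 : ∀ᵐ x ∂μ, Tendsto (fun N => G N x) atTop (𝓝 0))
    (hle : ∀ᵐ x ∂μ, ∀ N ≥ 1, ∀ k ≥ N, |u k x - v x| ≤ G N x) :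
    ∀ᵐ x ∂μ, Tendsto (fun n : ℕ => (∑ k ∈ Finset.range n, u k (T^[k] x)) / n) atTop
      (𝓝 (∫ x, v x ∂μ)) := by
  have hint : Tendsto (fun N => ∫ x, G N x ∂μ) atTop (𝓝 0) := by
    have h := tendsto_integral_filter_of_dominated_convergence (μ := μ) (F := G) (f := fun _ => 0)
      (l := atTop) (G 1) (Eventually.of_forall fun N => (hGm N).aestronglyMeasurable)
      ((eventually_ge_atTop 1).mono hG1) (hG 1 le_rfl) hG0
    simpa using h
  have horbit : ∀ᵐ x ∂μ, ∀ j : ℕ, ∀ N ≥ 1, ∀ k ≥ N,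
      |u k (T^[j] x) - v (T^[j] x)| ≤ G N (T^[j] x) := by
    rw [ae_all_iff]
    intro j
    exact (hT.toMeasurePreserving.iterate j).quasiMeasurePreserving.ae hle
  have hGb : ∀ᵐ x ∂μ, ∀ N : ℕ, N ≥ 1 → Tendsto (fun n : ℕ => birkhoffSum T (G N) n x / n) atTop
      (𝓝 (∫ x, G N x ∂μ)) := by
    rw [ae_all_iff]
    intro N
    by_cases hN : N ≥ 1
    · filter_upwards [tendsto_birkhoffSum_div hT (hGm N) (hG N hN)] with x hx _ using hx
    · exact ae_of_all _ fun x h => absurd h hN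
  filter_upwards [horbit, hGb, tendsto_birkhoffSum_div hT hvm hv] with x hx hGx hvx
  rw [Metric.tendsto_atTop'] at hvx ⊢
  intro ε hε
  have hε3 : 0 < ε / 3 := by positivity
  obtain ⟨N, hNε, hN⟩ := ((hint.eventually_lt_const hε3).and (eventually_ge_atTop 1)).exists
  have hC : Tendsto (fun n : ℕ =>
      (∑ k ∈ Finset.range N, |u k (T^[k] x) - v (T^[k] x)|) / (n : ℝ)) atTop (𝓝 0) :=
    tendsto_const_div_atTop_nhds_zero_nat _
  obtain ⟨n₀, hn₀⟩ := hvx (ε / 3) hε3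
  obtain ⟨n₁, hn₁⟩ := eventually_atTop.1 (((hGx N hN).eventually_lt_const hNε).and
    (hC.eventually_lt_const hε3))
  refine ⟨max n₀ (max n₁ N), fun n hn => ?_⟩
  have h0 := hn₀ n (by omega)
  obtain ⟨h1, h2⟩ := hn₁ n (by omega)
  have hnN : N ≤ n := by omega
  have hn0 : (0 : ℝ) < n := by exact_mod_cast (by omega : 0 < n)
  have hGnn : ∀ k, 0 ≤ G N (T^[k] x) := fun k => (abs_nonneg _).trans (hx k N hN N le_rfl)
  -- The bound by `G N` is available only for `k ≥ N`. The first `N` errors form a constant that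
  -- disappears after division by `n`; the others are absorbed by a Birkhoff sum of `G N`, whose
  -- average tends to less than `ε / 3`.
  have h3 : |∑ k ∈ Finset.range n, u k (T^[k] x) - birkhoffSum T v n x| ≤
      ∑ k ∈ Finset.range N, |u k (T^[k] x) - v (T^[k] x)| + birkhoffSum T (G N) n x := by
    rw [birkhoffSum, birkhoffSum, ← Finset.sum_sub_distrib]
    refine (Finset.abs_sum_le_sum_abs _ _).trans ?_
    rw [← Finset.sum_range_add_sum_Ico _ hnN]
    gcongr
    calc _ ≤ ∑ k ∈ Finset.Ico N n, G N (T^[k] x) := by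
          refine Finset.sum_le_sum fun k hk => hx k N hN k (Finset.mem_Ico.1 hk).1
      _ ≤ _ := by
          refine Finset.sum_le_sum_of_subset_of_nonneg ?_ fun k _ _ => hGnn k
          intro k hk
          simp only [Finset.mem_Ico, Finset.mem_range] at hk ⊢
          exact hk.2
  rw [Real.dist_eq] at h0 ⊢
  have h4 : |(∑ k ∈ Finset.range n, u k (T^[k] x)) / n - birkhoffSum T v n x / n| ≤
      (∑ k ∈ Finset.range N, |u k (T^[k] x) - v (T^[k] x)|) / n + birkhoffSum T (G N) n x / n := by
    rw [← sub_div, ← add_div, abs_div, abs_of_pos hn0]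
    gcongr
  have h5 := abs_sub_le ((∑ k ∈ Finset.range n, u k (T^[k] x)) / (n : ℝ))
    (birkhoffSum T v n x / n) (∫ x, v x ∂μ)
  linarith

/-! ### The two-sided extension -/

lemma IsTwoSidedExtension.isProbabilityMeasure {P : Measure (ℕ → Bool)} [IsProbabilityMeasure P]
    {Q : Measure (ℤ → Bool)} (h : IsTwoSidedExtension P Q) : IsProbabilityMeasure Q := by
  constructor
  simpa using h.restrict.measure_preimage MeasurableSet.univ.nullMeasurableSet

lemma shiftZ_iterate (k : ℕ) (ω : ℤ → Bool) (i : ℤ) : shiftZ^[k] ω i = ω (i + k) := by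
  induction k generalizing i with
  | zero => simp
  | succ k ih =>
    rw [Function.iterate_succ_apply', shiftZ, ih]
    congr 1
    push_cast
    ring

/-- A cylinder set becomes, after a shift, a set of the nonnegative coordinates. -/
lemma exists_preimage_shiftZ_iterate_eq {B : Set (ℤ → Bool)}
    (hB : B ∈ measurableCylinders fun _ : ℤ => Bool) :
    ∃ (m : ℕ) (C : Set (ℕ → Bool)), MeasurableSet C ∧ shiftZ^[m] ⁻¹' B = restrictNat ⁻¹' C := by
  obtain ⟨J, S, hS, rfl⟩ := (mem_measurableCylinders B).1 hB
  obtain ⟨m, hm⟩ : ∃ m : ℕ, ∀ j ∈ J, -(m : ℤ) ≤ j := by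
    refine ⟨J.sup Int.natAbs, fun j hj => ?_⟩
    have := Finset.le_sup (f := Int.natAbs) hj
    omega
  refine ⟨m, {η : ℕ → Bool | (fun j : J => η ((j : ℤ) + m).toNat) ∈ S}, ?_, ?_⟩
  · have : Measurable (fun η : ℕ → Bool => fun j : J => η ((j : ℤ) + m).toNat) := by fun_prop
    exact this hS
  · ext ω
    rw [Set.mem_preimage, mem_cylinder]
    show _ ↔ (fun j : J => ω (((j : ℤ) + m).toNat : ℤ)) ∈ S
    have : (fun j : J => ω (((j : ℤ) + m).toNat : ℤ)) = J.restrict (shiftZ^[m] ω) := by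
      funext j
      have := hm j j.2
      rw [Finset.restrict, shiftZ_iterate]
      congr 1
      omega
    rw [this]

lemma preimage_iterate_eq {α : Type*} {T : α → α} {A : Set α} (h : T ⁻¹' A = A) (m : ℕ) :
    T^[m] ⁻¹' A = A := by
  induction m with
  | zero => rfl
  | succ m ih => rw [Function.iterate_succ', Set.preimage_comp, h, ih]

/-- An invariant event of the two-sided sequences is, up to a null set, an event of the
nonnegative coordinates. -/
lemma IsTwoSidedExtension.exists_ae_eq_preimage_restrictNat {P : Measure (ℕ → Bool)}
    [IsProbabilityMeasure P] {Q : Measure (ℤ → Bool)} (h : IsTwoSidedExtension P Q)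
    {A : Set (ℤ → Bool)} (hA : MeasurableSet A) (hinv : shiftZ ⁻¹' A = A) :
    ∃ C : Set (ℕ → Bool), MeasurableSet C ∧ restrictNat ⁻¹' C =ᵐ[Q] A := by
  have := h.isProbabilityMeasure
  have hdense : Q.MeasureDense (measurableCylinders fun _ : ℤ => Bool) :=
    Measure.MeasureDense.of_generateFrom_isSetAlgebra_finite Q isSetAlgebra_measurableCylinders
      generateFrom_measurableCylinders.symm
  have happrox : ∀ n : ℕ, ∃ C : Set (ℕ → Bool), MeasurableSet C ∧
      Q (symmDiff A (restrictNat ⁻¹' C)) < ENNReal.ofReal ((1 / 2) ^ n) := by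
    intro n
    obtain ⟨B, hB, hAB⟩ := hdense.approx A hA (measure_ne_top Q A) ((1 / 2) ^ n) (by positivity)
    obtain ⟨m, C, hC, hBC⟩ := exists_preimage_shiftZ_iterate_eq hB
    refine ⟨C, hC, ?_⟩
    -- Since `A` is invariant, shifting the approximating cylinder `B` to nonnegative coordinates
    -- does not change the measure of its symmetric difference with `A`.
    rw [← hBC]
    conv_lhs => rw [← preimage_iterate_eq hinv m]
    rw [← Set.preimage_symmDiff, (h.invariant.iterate m).measure_preimage
      (hA.symmDiff (hdense.measurable B hB)).nullMeasurableSet]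
    exact hAB
  choose C hC hAC using happrox
  refine ⟨limsup C atTop, MeasurableSet.measurableSet_limsup hC, ?_⟩
  -- Borel–Cantelli: the errors are summable, so almost every point is eventually classified
  -- correctly by `C n`, and the limsup recovers `A`.
  have hsum : ∑' n, Q (symmDiff A (restrictNat ⁻¹' C n)) ≠ ∞ := by
    refine ne_top_of_le_ne_top ?_ (ENNReal.tsum_le_tsum fun n => (hAC n).le)
    rw [← ENNReal.ofReal_tsum_of_nonneg (fun n => by positivity) summable_geometric_two]
    exact ENNReal.ofReal_ne_top
  filter_upwards [ae_eventually_notMem hsum] with ω hω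
  have hiff : ∀ᶠ n in atTop, (restrictNat ω ∈ C n ↔ ω ∈ A) := by
    filter_upwards [hω] with n hn
    by_contra hne
    apply hn
    rw [Set.mem_symmDiff, Set.mem_preimage]
    tauto
  have : (restrictNat ω ∈ limsup C atTop) = (ω ∈ A) := by
    rw [mem_limsup_iff_frequently_mem, frequently_congr hiff]
    simp
  exact this

/-- An invariant event agrees almost surely with one of the nonnegative coordinates. Restriction
intertwines the shifts, so the one-sided event is almost invariant, hence trivial by the ergodicity
of `P`. -/
theorem IsTwoSidedExtension.ergodic {P : Measure (ℕ → Bool)} [IsProbabilityMeasure P]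
    (hP : Ergodic shift P) {Q : Measure (ℤ → Bool)} (h : IsTwoSidedExtension P Q) :
    Ergodic shiftZ Q := by
  refine ⟨h.invariant, ⟨fun A hA hinv => ?_⟩⟩
  obtain ⟨C, hC, hCA⟩ := h.exists_ae_eq_preimage_restrictNat hA hinv
  have hQ : restrictNat ⁻¹' (shift ⁻¹' C) =ᵐ[Q] restrictNat ⁻¹' C := by
    have h1 : shiftZ ⁻¹' (restrictNat ⁻¹' C) =ᵐ[Q] shiftZ ⁻¹' A :=
      h.invariant.quasiMeasurePreserving.preimage_ae_eq hCA
    rw [hinv] at h1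
    exact h1.trans hCA.symm
  have hPC : shift ⁻¹' C =ᵐ[P] C := by
    rw [← measure_symmDiff_eq_zero_iff] at hQ ⊢
    rw [← h.restrict.measure_preimage ((hP.measurable hC).symmDiff hC).nullMeasurableSet]
    exact hQ
  have hconst := hP.quasiErgodic.aeconst_set₀ hC.nullMeasurableSet hPC
  exact (hconst.comp_tendsto h.restrict.quasiMeasurePreserving.tendsto_ae).congr hCA

/-! ### Optimal predictions -/

/-- The expected loss of the prediction `γ` when the bit `0` has probability `p`. -/
noncomputable def risk (lam : Bool → I → ℝ≥0∞) (p γ : I) : ℝ≥0∞ :=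
  ENNReal.ofReal p * lam false γ + ENNReal.ofReal (1 - p) * lam true γ

section Optimal

variable {lam : Bool → I → ℝ≥0∞} {s : I → I}

lemma risk_le_sum (p γ : I) : risk lam p γ ≤ lam false γ + lam true γ := by
  refine add_le_add (mul_le_of_le_one_left' ?_) (mul_le_of_le_one_left' ?_)
  · exact ENNReal.ofReal_le_one.2 p.2.2
  · exact ENNReal.ofReal_le_one.2 (by linarith [p.2.1])

lemma IsRegular.continuous_apply (hreg : IsRegular lam) (b : Bool) : Continuous (lam b) :=
  hreg.continuous.comp (by fun_prop : Continuous fun γ : I => (b, γ))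

lemma IsRegular.risk_ne_top (hreg : IsRegular lam) (hs : IsOptimalMap lam s) (p : I) :
    risk lam p (s p) ≠ ∞ := by
  obtain ⟨γ, hγ⟩ := hreg.exists_finite
  exact ne_top_of_le_ne_top (ENNReal.add_ne_top.2 ⟨(hγ false).ne, (hγ true).ne⟩)
    ((hs p γ).trans (risk_le_sum p γ))

/-- Both bits must have positive weight: for `p = 0` or `p = 1` the convention `0 * ∞ = 0` can hide
an infinite loss. -/
lemma ne_top_of_risk_ne_top {p γ : I} (hp0 : 0 < p) (hp1 : p < 1) (h : risk lam p γ ≠ ∞)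
    (b : Bool) : lam b γ ≠ ∞ := by
  have hp0' : (0 : ℝ) < p := hp0
  have hp1' : (p : ℝ) < 1 := hp1
  rw [risk, ENNReal.add_ne_top] at h
  intro htop
  cases b with
  | false =>
    rw [htop, ENNReal.mul_top (by simpa using hp0')] at h
    exact h.1 rfl
  | true =>
    rw [htop, ENNReal.mul_top (by simpa using hp1')] at h
    exact h.2 rfl

lemma risk_eq_ofReal {p γ : I} (h : ∀ b, lam b γ ≠ ∞) :
    risk lam p γ =
      ENNReal.ofReal (p * (lam false γ).toReal + (1 - p) * (lam true γ).toReal) := by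
  have h1 : (0 : ℝ) ≤ 1 - p := by linarith [p.2.2]
  rw [risk, ENNReal.ofReal_add (mul_nonneg p.2.1 ENNReal.toReal_nonneg)
    (mul_nonneg h1 ENNReal.toReal_nonneg), ENNReal.ofReal_mul p.2.1, ENNReal.ofReal_mul h1,
    ENNReal.ofReal_toReal (h _), ENNReal.ofReal_toReal (h _)]

lemma risk_le_risk_iff {p γ γ' : I} (h : ∀ b, lam b γ ≠ ∞) (h' : ∀ b, lam b γ' ≠ ∞) :
    risk lam p γ ≤ risk lam p γ' ↔
      p * (lam false γ).toReal + (1 - p) * (lam true γ).toReal ≤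
        p * (lam false γ').toReal + (1 - p) * (lam true γ').toReal := by
  have h1 : (0 : ℝ) ≤ 1 - p := by linarith [p.2.2]
  rw [risk_eq_ofReal h, risk_eq_ofReal h', ENNReal.ofReal_le_ofReal_iff]
  exact add_nonneg (mul_nonneg p.2.1 ENNReal.toReal_nonneg) (mul_nonneg h1 ENNReal.toReal_nonneg)

/-- If the optimal prediction can be chosen continuously, then all the optimal predictions for a
nondegenerate distribution have the same losses. -/
theorem IsRegular.eq_of_risk_eq (hreg : IsRegular lam) (hsc : Continuous s)
    (hs : IsOptimalMap lam s) {p γ : I} (hp0 : 0 < p) (hp1 : p < 1)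
    (h : risk lam p γ = risk lam p (s p)) (b : Bool) : lam b γ = lam b (s p) := by
  have hγ : ∀ b, lam b γ ≠ ∞ := ne_top_of_risk_ne_top hp0 hp1 (h ▸ hreg.risk_ne_top hs p)
  have hsq : ∀ q : I, 0 < q → q < 1 → ∀ b, lam b (s q) ≠ ∞ := fun q h0 h1 =>
    ne_top_of_risk_ne_top h0 h1 (hreg.risk_ne_top hs q)
  have hcont : ∀ b, Continuous fun q => lam b (s q) := fun b => (hreg.continuous_apply b).comp hsc
  -- `s q` is at least as good as `γ` at `q`, while `γ` is optimal at `p`. Combining the two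
  -- inequalities, `s q` loses no more than `γ` on `true` if `q < p`, and no more on `false` if `q >
  -- p`. Letting `q → p` from each side gives both bounds for `s p`, and equality of the risks makes
  -- them equalities.
  have hcomp : ∀ q : I, 0 < q → q < 1 →
      q * (lam false (s q)).toReal + (1 - q) * (lam true (s q)).toReal ≤
        q * (lam false γ).toReal + (1 - q) * (lam true γ).toReal ∧
      p * (lam false γ).toReal + (1 - p) * (lam true γ).toReal ≤
        p * (lam false (s q)).toReal + (1 - p) * (lam true (s q)).toReal := fun q h0 h1 =>
    ⟨(risk_le_risk_iff (hsq q h0 h1) hγ).1 (hs q γ),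
      (risk_le_risk_iff hγ (hsq q h0 h1)).1 (h.trans_le (hs p _))⟩
  have htrue : lam true (s p) ≤ lam true γ := by
    have : (𝓝[<] p).NeBot := nhdsLT_neBot_of_exists_lt ⟨0, hp0⟩
    have ht : Tendsto (fun q => lam true (s q)) (𝓝[<] p) (𝓝 (lam true (s p))) :=
      (hcont true).continuousAt.tendsto.mono_left nhdsWithin_le_nhds
    refine le_of_tendsto ht ?_
    filter_upwards [self_mem_nhdsWithin,
      mem_nhdsWithin_of_mem_nhds (Ioi_mem_nhds hp0)] with q hqp hq0
    have hq1 : q < 1 := lt_trans hqp hp1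
    obtain ⟨h1, h2⟩ := hcomp q hq0 hq1
    rw [← ENNReal.toReal_le_toReal (hsq q hq0 hq1 true) (hγ true)]
    have e0 : (0 : ℝ) < q := hq0
    have e1 : (q : ℝ) < p := hqp
    have e2 : (p : ℝ) < 1 := hp1
    by_contra! hlt
    nlinarith
  have hfalse : lam false (s p) ≤ lam false γ := by
    have : (𝓝[>] p).NeBot := nhdsGT_neBot_of_exists_gt ⟨1, hp1⟩
    have ht : Tendsto (fun q => lam false (s q)) (𝓝[>] p) (𝓝 (lam false (s p))) :=
      (hcont false).continuousAt.tendsto.mono_left nhdsWithin_le_nhds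
    refine le_of_tendsto ht ?_
    filter_upwards [self_mem_nhdsWithin,
      mem_nhdsWithin_of_mem_nhds (Iio_mem_nhds hp1)] with q hqp hq1
    have hq0 : 0 < q := lt_trans hp0 hqp
    obtain ⟨h1, h2⟩ := hcomp q hq0 hq1
    rw [← ENNReal.toReal_le_toReal (hsq q hq0 hq1 false) (hγ false)]
    have e0 : (q : ℝ) < 1 := hq1
    have e1 : (p : ℝ) < q := hqp
    have e2 : (0 : ℝ) < p := hp0
    by_contra! hlt
    nlinarith
  have hsp := hsq p hp0 hp1
  obtain ⟨-, h3⟩ := hcomp p hp0 hp1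
  have e0 : (0 : ℝ) < p := hp0
  have e1 : (p : ℝ) < 1 := hp1
  rw [← ENNReal.toReal_le_toReal (hsp _) (hγ _)] at htrue hfalse
  rw [← ENNReal.toReal_eq_toReal_iff' (hγ b) (hsp b)]
  cases b <;> refine le_antisymm ?_ ‹_› <;> by_contra! hlt <;> nlinarith

end Optimal

/-! ### Strategies -/

lemma measurable_pre (n : ℕ) : Measurable (pre n) := by unfold pre; fun_prop

lemma measurableSet_cyl {n : ℕ} (w : Fin n → Bool) : MeasurableSet (cyl w) :=
  measurable_pre n (measurableSet_singleton w)

/-- The set of sequences with the prefix `x` followed by the bit `b`. -/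
def cylSnoc {k : ℕ} (x : Fin k → Bool) (b : Bool) : Set (ℕ → Bool) := {ω | pre k ω = x ∧ ω k = b}

lemma measurableSet_cylSnoc {k : ℕ} (x : Fin k → Bool) (b : Bool) :
    MeasurableSet (cylSnoc x b) := by
  have h : Measurable fun ω : ℕ → Bool => ω k := measurable_pi_apply k
  exact (measurableSet_cyl x).inter (h (measurableSet_singleton b))

lemma cyl_eq_union {k : ℕ} (x : Fin k → Bool) : cyl x = cylSnoc x false ∪ cylSnoc x true := by
  ext ω
  cases h : ω k <;> simp [cyl, cylSnoc, h]

lemma disjoint_cylSnoc {k : ℕ} (x : Fin k → Bool) :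
    Disjoint (cylSnoc x false) (cylSnoc x true) := by
  rw [Set.disjoint_left]
  rintro ω ⟨-, h⟩ ⟨-, h'⟩
  simp [h] at h'

lemma lintegral_pre {P : Measure (ℕ → Bool)} (n : ℕ) (f : (Fin n → Bool) → ℝ≥0∞) :
    ∫⁻ ω, f (pre n ω) ∂P = ∑ w, P (cyl w) * f w := by
  rw [← lintegral_map (μ := P) (measurable_of_countable f) (measurable_pre n), lintegral_fintype]
  refine Finset.sum_congr rfl fun w _ => ?_
  rw [Measure.map_apply (measurable_pre n) (measurableSet_singleton w), mul_comm]
  rfl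

/-- The prefix together with the next bit takes only finitely many values, so values of probability
zero are almost surely avoided. -/
lemma ae_measure_cylSnoc_ne_zero {P : Measure (ℕ → Bool)} (k : ℕ) :
    ∀ᵐ ω ∂P, P (cylSnoc (pre k ω) (ω k)) ≠ 0 := by
  have hm : Measurable fun ω : ℕ → Bool => (pre k ω, ω k) :=
    (measurable_pre k).prodMk (measurable_pi_apply k)
  have : ∀ᵐ z ∂(P.map fun ω : ℕ → Bool => (pre k ω, ω k)), P (cylSnoc z.1 z.2) ≠ 0 := by
    rw [ae_iff_of_countable]
    rintro ⟨x, b⟩ hz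
    rw [Measure.map_apply hm (measurableSet_singleton _)] at hz
    convert hz using 2
    ext ω
    simp [cylSnoc]
  exact ae_of_ae_map hm.aemeasurable this

lemma loss_pre (lam : Bool → I → ℝ≥0∞) (S : Strategy) (n : ℕ) (ω : ℕ → Bool) :
    loss lam (pre n ω) S = ∑ k ∈ Finset.range n, lam (ω k) (S k (pre k ω)) := by
  rw [Finset.sum_range]
  rfl

lemma measurable_step (lam : Bool → I → ℝ≥0∞) (S : Strategy) (k : ℕ) :
    Measurable fun ω : ℕ → Bool => lam (ω k) (S k (pre k ω)) :=
  (measurable_of_countable (fun z : (Fin k → Bool) × Bool => lam z.2 (S k z.1))).comp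
    ((measurable_pre k).prodMk (measurable_pi_apply k))

lemma expectedLoss_eq_sum_lintegral {P : Measure (ℕ → Bool)} (lam : Bool → I → ℝ≥0∞)
    (S : Strategy) (n : ℕ) :
    expectedLoss lam P n S = ∑ k ∈ Finset.range n, ∫⁻ ω, lam (ω k) (S k (pre k ω)) ∂P := by
  rw [expectedLoss, ← lintegral_pre n fun w => loss lam w S]
  simp_rw [loss_pre]
  exact lintegral_finsetSum _ fun k _ => measurable_step lam S k

variable (P : Measure (ℕ → Bool)) [IsProbabilityMeasure P]

lemma measureReal_cyl_eq_add {k : ℕ} (x : Fin k → Bool) :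
    P.real (cyl x) = P.real (cylSnoc x false) + P.real (cylSnoc x true) := by
  rw [cyl_eq_union, measureReal_union (disjoint_cylSnoc x) (measurableSet_cylSnoc x true)]

/-- The conditional probability of the bit `0` after the word `x`. -/
noncomputable def nextProb {k : ℕ} (x : Fin k → Bool) : I :=
  ⟨P.real (cylSnoc x false) / P.real (cyl x), by positivity, by
    refine div_le_one_of_le₀ ?_ measureReal_nonneg
    rw [measureReal_cyl_eq_add]
    exact le_add_of_nonneg_right measureReal_nonneg⟩

lemma measureReal_cyl_mul_nextProb {k : ℕ} (x : Fin k → Bool) :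
    P.real (cyl x) * nextProb P x = P.real (cylSnoc x false) := by
  show P.real (cyl x) * (P.real (cylSnoc x false) / P.real (cyl x)) = _
  -- On a null cylinder the quotient is `0` by convention; the identity survives because both halves
  -- are null too.
  refine mul_div_cancel_of_imp' fun h => ?_
  have := measureReal_cyl_eq_add P x
  have h1 : 0 ≤ P.real (cylSnoc x false) := measureReal_nonneg
  have h2 : 0 ≤ P.real (cylSnoc x true) := measureReal_nonneg
  linarith

lemma measure_cylSnoc_false {k : ℕ} (x : Fin k → Bool) :
    P (cylSnoc x false) = P (cyl x) * ENNReal.ofReal (nextProb P x) := by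
  rw [← ofReal_measureReal, ← ofReal_measureReal, ← ENNReal.ofReal_mul measureReal_nonneg,
    measureReal_cyl_mul_nextProb]

lemma measure_cylSnoc_true {k : ℕ} (x : Fin k → Bool) :
    P (cylSnoc x true) = P (cyl x) * ENNReal.ofReal (1 - nextProb P x) := by
  rw [← ofReal_measureReal, ← ofReal_measureReal, ← ENNReal.ofReal_mul measureReal_nonneg,
    mul_sub, measureReal_cyl_mul_nextProb, measureReal_cyl_eq_add, mul_one, add_sub_cancel_left]

/-- The strategy which makes the optimal prediction for the conditional probability of the
next bit. -/
noncomputable def optStrategy (s : I → I) : Strategy := fun _ x => s (nextProb P x)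

variable {P} (lam : Bool → I → ℝ≥0∞)

/-- Conditioning on the prefix decouples the predictions: each word contributes its own risk, which
can be minimized separately. -/
lemma lintegral_step (S : Strategy) (k : ℕ) :
    ∫⁻ ω, lam (ω k) (S k (pre k ω)) ∂P = ∑ x, P (cyl x) * risk lam (nextProb P x) (S k x) := by
  have hm : Measurable fun ω : ℕ → Bool => (pre k ω, ω k) :=
    (measurable_pre k).prodMk (measurable_pi_apply k)
  rw [← lintegral_map (μ := P) (f := fun z : (Fin k → Bool) × Bool => lam z.2 (S k z.1))
    (measurable_of_countable _) hm, lintegral_fintype, Fintype.sum_prod_type]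
  refine Finset.sum_congr rfl fun x _ => ?_
  have h : ∀ b, (Measure.map (fun ω : ℕ → Bool => (pre k ω, ω k)) P) {(x, b)} =
      P (cylSnoc x b) := by
    intro b
    rw [Measure.map_apply hm (measurableSet_singleton _)]
    congr 1
    ext ω
    simp [cylSnoc]
  rw [Fintype.sum_bool, h, h, measure_cylSnoc_true, measure_cylSnoc_false, risk]
  ring

variable {lam} {s : I → I}

lemma lintegral_optStrategy_le (hs : IsOptimalMap lam s) (S : Strategy) (k : ℕ) :
    ∫⁻ ω, lam (ω k) (optStrategy P s k (pre k ω)) ∂P ≤ ∫⁻ ω, lam (ω k) (S k (pre k ω)) ∂P := by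
  rw [lintegral_step, lintegral_step]
  exact Finset.sum_le_sum fun x _ => mul_le_mul_right (hs _ _) _

/-- The expected losses of the optimal strategy are uniformly bounded. -/
lemma lintegral_optStrategy_le_sum (hs : IsOptimalMap lam s) (γ : I) (k : ℕ) :
    ∫⁻ ω, lam (ω k) (optStrategy P s k (pre k ω)) ∂P ≤ lam false γ + lam true γ := by
  refine (lintegral_optStrategy_le hs (fun _ _ => γ) k).trans ?_
  calc _ ≤ ∫⁻ _, (lam false γ + lam true γ) ∂P := by
        refine lintegral_mono fun ω => ?_
        cases ω k
        · exact le_self_add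
        · exact le_add_self
    _ = _ := by simp

lemma lintegral_optStrategy_ne_top (hreg : IsRegular lam) (hs : IsOptimalMap lam s) (k : ℕ) :
    ∫⁻ ω, lam (ω k) (optStrategy P s k (pre k ω)) ∂P ≠ ∞ := by
  obtain ⟨γ, hγ⟩ := hreg.exists_finite
  exact ne_top_of_le_ne_top (ENNReal.add_ne_top.2 ⟨(hγ false).ne, (hγ true).ne⟩)
    (lintegral_optStrategy_le_sum hs γ k)

lemma stepEntropy_eq_sum (hs : IsOptimalMap lam s) (n : ℕ) :
    stepEntropy lam P n =
      ∑ k ∈ Finset.range n, ∫⁻ ω, lam (ω k) (optStrategy P s k (pre k ω)) ∂P := by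
  refine le_antisymm ?_ (le_iInf fun S => ?_)
  · exact (iInf_le _ (optStrategy P s)).trans_eq (expectedLoss_eq_sum_lintegral lam _ n)
  · rw [expectedLoss_eq_sum_lintegral]
    exact Finset.sum_le_sum fun k _ => lintegral_optStrategy_le hs S k

/-- Finiteness of the sum allows the remaining terms to be cancelled in `[0, ∞]`. -/
lemma eq_of_sum_le_sum {ι : Type*} [DecidableEq ι] {t : Finset ι} {f g : ι → ℝ≥0∞}
    (hfg : ∀ i ∈ t, f i ≤ g i) (hgf : ∑ i ∈ t, g i ≤ ∑ i ∈ t, f i) (hf : ∑ i ∈ t, f i ≠ ∞) {i : ι}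
    (hi : i ∈ t) : f i = g i := by
  refine le_antisymm (hfg i hi) ?_
  rw [← Finset.add_sum_erase t f hi, ← Finset.add_sum_erase t g hi] at hgf
  rw [← Finset.add_sum_erase t f hi] at hf
  refine (ENNReal.add_le_add_iff_right (ENNReal.add_ne_top.1 hf).2).1 (le_trans ?_ hgf)
  gcongr with j hj
  exact hfg j (Finset.mem_of_mem_erase hj)

/-- Almost surely, a strategy which attains `H_n` suffers the same losses in the first `n` steps
as the strategy `optStrategy`. -/
theorem IsRegular.ae_loss_eq_optStrategy (hreg : IsRegular lam) (hsc : Continuous s)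
    (hs : IsOptimalMap lam s) {n : ℕ} {S : Strategy}
    (hS : expectedLoss lam P n S = stepEntropy lam P n) :
    ∀ᵐ ω ∂P, loss lam (pre n ω) S = loss lam (pre n ω) (optStrategy P s) := by
  rw [stepEntropy_eq_sum hs, expectedLoss_eq_sum_lintegral] at hS
  -- Equality of the totals descends first to each time `k`, then to each word `x`; positive
  -- probability permits cancelling the weight.
  have hterm : ∀ k < n, ∀ x : Fin k → Bool, P (cyl x) ≠ 0 →
      risk lam (nextProb P x) (S k x) = risk lam (nextProb P x) (s (nextProb P x)) := by
    intro k hk x hx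
    have h1 := eq_of_sum_le_sum (fun k _ => lintegral_optStrategy_le hs S k) hS.le
      (ENNReal.sum_ne_top.2 fun k _ => lintegral_optStrategy_ne_top hreg hs k)
      (Finset.mem_range.2 hk)
    have htop := lintegral_optStrategy_ne_top (P := P) hreg hs k
    rw [lintegral_step, lintegral_step] at h1
    rw [lintegral_step] at htop
    have h2 := eq_of_sum_le_sum (fun x _ => mul_le_mul_right (hs (nextProb P x) (S k x)) _)
      h1.ge htop (Finset.mem_univ x)
    exact ((ENNReal.mul_right_inj hx (measure_ne_top P _)).1 h2).symm
  filter_upwards [ae_all_iff.2 ae_measure_cylSnoc_ne_zero] with ω hω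
  rw [loss_pre, loss_pre]
  refine Finset.sum_congr rfl fun k hk => ?_
  have hcyl : P (cyl (pre k ω)) ≠ 0 := fun h0 => hω k (measure_mono_null (fun η hη => hη.1) h0)
  have hr := hterm k (Finset.mem_range.1 hk) _ hcyl
  show _ = lam (ω k) (s (nextProb P (pre k ω)))
  have hωk := hω k
  generalize hx : pre k ω = x at hr hωk ⊢
  generalize hp : nextProb P x = p at hr ⊢
  -- For degenerate `p` the risk is the loss on the certain bit alone; the other bit has been
  -- excluded almost surely by `hω`.
  rcases (bot_le : 0 ≤ p).eq_or_lt with h0 | h0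
  · subst h0
    cases hb : ω k with
    | false =>
      rw [hb, measure_cylSnoc_false, hp] at hωk
      simp at hωk
    | true => simpa [risk] using hr
  rcases (le_top : p ≤ 1).eq_or_lt with h1 | h1
  · subst h1
    cases hb : ω k with
    | false => simpa [risk] using hr
    | true =>
      rw [hb, measure_cylSnoc_true, hp] at hωk
      simp at hωk
  · exact hreg.eq_of_risk_eq hsc hs h0 h1 hr _

/-! ### Conditional probabilities given the past -/

lemma coordAlgebra_le (J : Set ℤ) : coordAlgebra J ≤ MeasurableSpace.pi :=
  iSup₂_le fun i _ => (measurable_pi_apply (X := fun _ : ℤ => Bool) i).comap_le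

lemma coordAlgebra_mono {J K : Set ℤ} (h : J ⊆ K) : coordAlgebra J ≤ coordAlgebra K :=
  biSup_mono h

/-- The `σ`-algebras of the coordinates `-k, …, -1`. -/
def pastFiltration : Filtration ℕ (MeasurableSpace.pi (X := fun _ : ℤ => Bool)) where
  seq k := coordAlgebra (Set.Ico (-(k : ℤ)) 0)
  mono' := fun k l hkl => coordAlgebra_mono (Set.Ico_subset_Ico_left (by omega))
  le' _ := coordAlgebra_le _

lemma iSup_pastFiltration : ⨆ k, pastFiltration k = coordAlgebra (Set.Iio 0) := by
  refine le_antisymm (iSup_le fun k => coordAlgebra_mono fun i hi => hi.2) ?_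
  refine iSup₂_le fun i hi => ?_
  refine le_trans ?_ (le_iSup _ i.natAbs)
  refine le_iSup₂_of_le i ⟨?_, hi⟩ le_rfl
  omega

/-- The sequence seen from the position `-k`. -/
def seenFrom (k : ℕ) (ω : ℤ → Bool) : ℕ → Bool := fun n => ω (n - k)

lemma measurable_seenFrom (k : ℕ) : Measurable (seenFrom k) := by unfold seenFrom; fun_prop

lemma seenFrom_shiftZ_iterate (k : ℕ) (ω : ℤ → Bool) :
    seenFrom k (shiftZ^[k] ω) = restrictNat ω := by
  funext n
  simp [seenFrom, shiftZ_iterate, restrictNat]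

lemma IsTwoSidedExtension.measurePreserving_seenFrom {P : Measure (ℕ → Bool)}
    {Q : Measure (ℤ → Bool)} (h : IsTwoSidedExtension P Q) (k : ℕ) :
    MeasurePreserving (seenFrom k) Q P := by
  refine ⟨measurable_seenFrom k, ?_⟩
  have hk := h.invariant.iterate k
  rw [← h.restrict.map_eq, ← hk.map_eq, Measure.map_map (measurable_seenFrom k) hk.measurable,
    hk.map_eq]
  congr 1
  funext ω
  exact seenFrom_shiftZ_iterate k ω

variable {P : Measure (ℕ → Bool)} [IsProbabilityMeasure P] {Q : Measure (ℤ → Bool)}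

/-- The word `ω_{-k} … ω_{-1}`. -/
def past (k : ℕ) (ω : ℤ → Bool) : Fin k → Bool := pre k (seenFrom k ω)

lemma measurable_past_coordAlgebra (k : ℕ) :
    Measurable[coordAlgebra (Set.Ico (-(k : ℤ)) 0)] (past k) := by
  refine @measurable_pi_lambda _ _ _ (coordAlgebra _) _ _ fun j => ?_
  have hj : ((j : ℕ) : ℤ) - k ∈ Set.Ico (-(k : ℤ)) 0 := by
    have := j.2
    constructor <;> omega
  exact Measurable.mono (comap_measurable _) (le_iSup₂_of_le _ hj le_rfl) le_rfl

lemma coordAlgebra_Ico_le_comap_past (k : ℕ) :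
    coordAlgebra (Set.Ico (-(k : ℤ)) 0) ≤ MeasurableSpace.comap (past k) inferInstance := by
  refine iSup₂_le fun i hi => ?_
  obtain ⟨h1, h2⟩ := hi
  have he : (fun ω : ℤ → Bool => ω i) =
      (fun x : Fin k → Bool => x ⟨(i + k).toNat, by omega⟩) ∘ past k := by
    funext ω
    show ω i = ω (((i + k).toNat : ℤ) - k)
    congr 1
    omega
  rw [he, ← MeasurableSpace.comap_comp]
  exact MeasurableSpace.comap_mono (measurable_pi_apply _).comap_le

/-- The past `σ`-algebra is finite, its events being unions of fibres of `past k`. On one fibre,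
viewing the sequence from `-k` turns the defining integral identity into
`measureReal_cyl_mul_nextProb`. -/
lemma IsTwoSidedExtension.condExp_ae_eq_nextProb (h : IsTwoSidedExtension P Q) (k : ℕ) :
    (fun ω => (nextProb P (past k ω) : ℝ)) =ᵐ[Q]
      Q[Set.indicator {η : ℤ → Bool | η 0 = false} (fun _ => (1 : ℝ)) |
        coordAlgebra (Set.Ico (-(k : ℤ)) 0)] := by
  have := h.isProbabilityMeasure
  have hpast : Measurable (past k) :=
    (measurable_past_coordAlgebra k).mono (coordAlgebra_le _) le_rfl
  have hzero : MeasurableSet {η : ℤ → Bool | η 0 = false} :=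
    measurableSet_eq_fun (measurable_pi_apply (0 : ℤ)) measurable_const
  have hgm : Measurable fun x : Fin k → Bool => (nextProb P x : ℝ) := measurable_of_countable _
  have hgi : Integrable (fun ω => (nextProb P (past k ω) : ℝ)) Q := by
    refine Integrable.of_bound (hgm.comp hpast).aestronglyMeasurable 1 (ae_of_all _ fun ω => ?_)
    rw [Real.norm_eq_abs, abs_of_nonneg (nextProb P _).2.1]
    exact (nextProb P _).2.2
  have hfi : Integrable (Set.indicator {η : ℤ → Bool | η 0 = false} fun _ => (1 : ℝ)) Q :=
    (integrable_const _).indicator hzero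
  refine ae_eq_condExp_of_forall_setIntegral_eq (coordAlgebra_le _) hfi
    (fun _ _ _ => hgi.integrableOn) ?_
    (hgm.comp (measurable_past_coordAlgebra k)).stronglyMeasurable.aestronglyMeasurable
  intro t ht _
  obtain ⟨B, -, rfl⟩ := coordAlgebra_Ico_le_comap_past k t ht
  have hcover : past k ⁻¹' B = ⋃ x ∈ B.toFinite.toFinset, past k ⁻¹' {x} := by
    ext ω
    simp
  have hdisj : Set.PairwiseDisjoint (↑B.toFinite.toFinset : Set (Fin k → Bool))
      fun x => past k ⁻¹' {x} := fun x _ y _ hxy =>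
    Disjoint.preimage _ (Set.disjoint_singleton.2 hxy)
  have hms : ∀ x, MeasurableSet (past k ⁻¹' {x}) := fun x => hpast (measurableSet_singleton x)
  rw [hcover, integral_biUnion_finset _ (fun x _ => hms x) hdisj fun x _ => hgi.integrableOn,
    integral_biUnion_finset _ (fun x _ => hms x) hdisj fun x _ => hfi.integrableOn]
  refine Finset.sum_congr rfl fun x _ => ?_
  have hc : ∫ ω in past k ⁻¹' {x}, (nextProb P (past k ω) : ℝ) ∂Q =
      ∫ ω in past k ⁻¹' {x}, (nextProb P x : ℝ) ∂Q := by
    refine setIntegral_congr_fun (hms x) fun ω hω => ?_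
    have : past k ω = x := hω
    simp only [this]
  have hP := h.measurePreserving_seenFrom k
  have h1 : past k ⁻¹' {x} = seenFrom k ⁻¹' cyl x := rfl
  have h2 : past k ⁻¹' {x} ∩ {η : ℤ → Bool | η 0 = false} = seenFrom k ⁻¹' cylSnoc x false := by
    ext ω
    have : seenFrom k ω k = ω 0 := by simp [seenFrom]
    simp only [cylSnoc, Set.mem_inter_iff, Set.mem_preimage, Set.mem_singleton_iff,
      Set.mem_ofPred_eq, this]
    rfl
  rw [hc, setIntegral_const, setIntegral_indicator hzero, setIntegral_const, h2, h1,
    hP.measureReal_preimage (measurableSet_cyl x).nullMeasurableSet,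
    hP.measureReal_preimage (measurableSet_cylSnoc x false).nullMeasurableSet, smul_eq_mul,
    smul_eq_mul, mul_one, measureReal_cyl_mul_nextProb]

lemma IsTwoSidedExtension.condProb_ae_eq_nextProb (h : IsTwoSidedExtension P Q) (k : ℕ) :
    ∀ᵐ ω ∂Q, condProb Q (Set.Ico (-(k : ℤ)) 0) ω = nextProb P (past k ω) := by
  filter_upwards [h.condExp_ae_eq_nextProb k] with ω hω
  rw [condProb, ← hω]
  exact Set.projIcc_val zero_le_one _

/-- Lévy's upward theorem, since the finite pasts generate the whole past. -/
lemma ae_tendsto_condProb [IsProbabilityMeasure Q] : ∀ᵐ ω ∂Q,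
    Tendsto (fun k : ℕ => condProb Q (Set.Ico (-(k : ℤ)) 0) ω) atTop
      (𝓝 (condProb Q (Set.Iio 0) ω)) := by
  have h := tendsto_ae_condExp (μ := Q) (ℱ := pastFiltration)
    (Set.indicator {η : ℤ → Bool | η 0 = false} fun _ => (1 : ℝ))
  rw [iSup_pastFiltration] at h
  filter_upwards [h] with ω hω
  exact (continuous_projIcc.tendsto _).comp hω

lemma measurable_condProb (Q : Measure (ℤ → Bool)) (J : Set ℤ) : Measurable (condProb Q J) :=
  continuous_projIcc.measurable.comp
    (stronglyMeasurable_condExp.measurable.mono (coordAlgebra_le J) le_rfl)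

/-! ### The losses `g_k` and their limit -/

variable {lam : Bool → I → ℝ≥0∞} {s : I → I}

lemma IsRegular.measurable_comp (hreg : IsRegular lam) {p : (ℤ → Bool) → I} (hsc : Continuous s)
    (hp : Measurable p) : Measurable fun ω : ℤ → Bool => lam (ω 0) (s (p ω)) := by
  have h : Measurable fun q : Bool × I => lam q.1 q.2 := hreg.continuous.measurable
  exact h.comp ((measurable_pi_apply (0 : ℤ)).prodMk (hsc.measurable.comp hp))

lemma IsRegular.measurable_gk (hreg : IsRegular lam) (hsc : Continuous s) (k : ℕ) :
    Measurable (gk lam Q s k) :=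
  hreg.measurable_comp hsc (measurable_condProb Q _)

lemma IsRegular.measurable_gLim (hreg : IsRegular lam) (hsc : Continuous s) :
    Measurable (gLim lam Q s) :=
  hreg.measurable_comp hsc (measurable_condProb Q _)

lemma IsRegular.measurable_gSup (hreg : IsRegular lam) (hsc : Continuous s) (N : ℕ) :
    Measurable (gSup lam Q s N) := by
  have hk := fun k => hreg.measurable_gk (Q := Q) hsc k
  have hl := hreg.measurable_gLim (Q := Q) hsc
  exact Measurable.iSup fun k => Measurable.iSup fun _ => ((hk k).sub hl).add (hl.sub (hk k))

lemma gSup_antitone (ω : ℤ → Bool) : Antitone fun N => gSup lam Q s N ω :=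
  fun _ _ h => biSup_mono fun _ hk => h.trans hk

lemma IsRegular.ae_tendsto_gk [IsProbabilityMeasure Q] (hreg : IsRegular lam)
    (hsc : Continuous s) :
    ∀ᵐ ω ∂Q, Tendsto (fun k => gk lam Q s k ω) atTop (𝓝 (gLim lam Q s ω)) := by
  filter_upwards [ae_tendsto_condProb (Q := Q)] with ω hω
  exact (((hreg.continuous_apply (ω 0)).comp hsc).tendsto _).comp hω

/-- Along the orbit of the shift, `g_k` gives the losses of the optimal strategy. -/
lemma IsTwoSidedExtension.ae_gk_shiftZ_iterate (h : IsTwoSidedExtension P Q)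
    (lam : Bool → I → ℝ≥0∞) (s : I → I) (k : ℕ) :
    ∀ᵐ ω ∂Q, gk lam Q s k (shiftZ^[k] ω) =
      lam (restrictNat ω k) (optStrategy P s k (pre k (restrictNat ω))) := by
  filter_upwards [(h.invariant.iterate k).quasiMeasurePreserving.ae
    (h.condProb_ae_eq_nextProb k)] with ω hω
  rw [gk, hω, past, seenFrom_shiftZ_iterate, shiftZ_iterate, zero_add]
  rfl

lemma IsTwoSidedExtension.lintegral_gk (h : IsTwoSidedExtension P Q) (hreg : IsRegular lam)
    (hsc : Continuous s) (k : ℕ) :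
    ∫⁻ ω, gk lam Q s k ω ∂Q = ∫⁻ ω, lam (ω k) (optStrategy P s k (pre k ω)) ∂P := by
  rw [← (h.invariant.iterate k).lintegral_comp (hreg.measurable_gk hsc k),
    lintegral_congr_ae (h.ae_gk_shiftZ_iterate lam s k)]
  exact h.restrict.lintegral_comp (measurable_step lam _ k)

/-- Fatou's lemma, the integrals of the `g_k` being bounded by the total loss of one fixed
finite-loss prediction. -/
lemma IsTwoSidedExtension.lintegral_gLim_ne_top (h : IsTwoSidedExtension P Q)
    (hreg : IsRegular lam) (hsc : Continuous s) (hs : IsOptimalMap lam s) :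
    ∫⁻ ω, gLim lam Q s ω ∂Q ≠ ∞ := by
  have := h.isProbabilityMeasure
  obtain ⟨γ, hγ⟩ := hreg.exists_finite
  refine ne_top_of_le_ne_top (ENNReal.add_ne_top.2 ⟨(hγ false).ne, (hγ true).ne⟩) ?_
  calc ∫⁻ ω, gLim lam Q s ω ∂Q
      = ∫⁻ ω, liminf (fun k => gk lam Q s k ω) atTop ∂Q := by
        refine lintegral_congr_ae ?_
        filter_upwards [hreg.ae_tendsto_gk (Q := Q) hsc] with ω hω
        exact hω.liminf_eq.symm
    _ ≤ liminf (fun k => ∫⁻ ω, gk lam Q s k ω ∂Q) atTop :=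
        lintegral_liminf_le fun k => hreg.measurable_gk hsc k
    _ ≤ liminf (fun _ : ℕ => lam false γ + lam true γ) atTop := by
        refine liminf_le_liminf (Eventually.of_forall fun k => ?_)
        rw [h.lintegral_gk hreg hsc]
        exact lintegral_optStrategy_le_sum hs γ k
    _ = _ := liminf_const _

/-- Cut at a level `α` where the tail integrals are below `1`; under it the function is bounded on a
finite measure space. -/
lemma UnifIntegrableSeq.lintegral_ne_top {Ω : Type*} [MeasurableSpace Ω] {μ : Measure Ω}
    [IsFiniteMeasure μ] {f : ℕ → Ω → ℝ≥0∞} (h : UnifIntegrableSeq μ f) {n : ℕ} (hn : 1 ≤ n)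
    (hf : Measurable (f n)) : ∫⁻ ω, f n ω ∂μ ≠ ∞ := by
  obtain ⟨α, hα⟩ := (h.eventually_lt_const zero_lt_one).exists
  have h1 : ∫⁻ ω in {ω | (α : ℝ≥0∞) < f n ω}, f n ω ∂μ < 1 :=
    (le_iSup₂ (f := fun n (_ : n ≥ 1) => ∫⁻ ω in {ω | (α : ℝ≥0∞) < f n ω}, f n ω ∂μ) n
      hn).trans_lt hα
  have hm : MeasurableSet {ω | (α : ℝ≥0∞) < f n ω} := measurableSet_lt measurable_const hf
  rw [← lintegral_add_compl _ hm]
  refine ENNReal.add_ne_top.2 ⟨(h1.trans ENNReal.one_lt_top).ne, ?_⟩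
  refine ne_top_of_le_ne_top (ENNReal.mul_ne_top ENNReal.coe_ne_top (measure_ne_top μ Set.univ))
    (b := (α : ℝ≥0∞) * μ Set.univ) ?_
  calc _ ≤ ∫⁻ _ in {ω | (α : ℝ≥0∞) < f n ω}ᶜ, (α : ℝ≥0∞) ∂μ :=
        setLIntegral_mono measurable_const fun ω hω => not_lt.1 hω
    _ ≤ _ := by
        rw [setLIntegral_const]
        gcongr
        exact Set.subset_univ _

lemma tendsto_gSup {ω : ℤ → Bool} (hfin : gLim lam Q s ω ≠ ∞)
    (h : Tendsto (fun k => gk lam Q s k ω) atTop (𝓝 (gLim lam Q s ω))) :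
    Tendsto (fun N => gSup lam Q s N ω) atTop (𝓝 0) := by
  have hd : Tendsto (fun k => (gk lam Q s k ω - gLim lam Q s ω) +
      (gLim lam Q s ω - gk lam Q s k ω)) atTop (𝓝 0) := by
    have h1 := ENNReal.Tendsto.sub h (tendsto_const_nhds (x := gLim lam Q s ω)) (Or.inr hfin)
    have h2 := ENNReal.Tendsto.sub (tendsto_const_nhds (x := gLim lam Q s ω)) h (Or.inl hfin)
    simpa using h1.add h2
  rw [ENNReal.tendsto_nhds_zero] at hd ⊢
  intro ε hε
  obtain ⟨N, hN⟩ := eventually_atTop.1 (hd ε hε)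
  filter_upwards [eventually_ge_atTop N] with n hn
  exact iSup₂_le fun k hk => hN k (hn.trans hk)

/-! ### Passage from `[0, ∞]` to real-valued functions -/

lemma abs_toReal_sub_le {a b c : ℝ≥0∞} (ha : a ≠ ∞) (hb : b ≠ ∞) (hc : c ≠ ∞)
    (h : (a - b) + (b - a) ≤ c) : |a.toReal - b.toReal| ≤ c.toReal := by
  rw [abs_sub_le_iff]
  constructor
  · have h1 : a - b ≤ c := le_self_add.trans h
    have h2 := ENNReal.toReal_mono (ENNReal.add_ne_top.2 ⟨hc, hb⟩) (tsub_le_iff_right.1 h1)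
    rw [ENNReal.toReal_add hc hb] at h2
    linarith
  · have h1 : b - a ≤ c := le_add_self.trans h
    have h2 := ENNReal.toReal_mono (ENNReal.add_ne_top.2 ⟨hc, ha⟩) (tsub_le_iff_right.1 h1)
    rw [ENNReal.toReal_add hc ha] at h2
    linarith

lemma tendsto_sum_div_of_toReal {a : ℕ → ℝ≥0∞} (ha : ∀ k, a k ≠ ∞) {c : ℝ}
    (h : Tendsto (fun n : ℕ => (∑ k ∈ Finset.range n, (a k).toReal) / n) atTop (𝓝 c)) :
    Tendsto (fun n : ℕ => (∑ k ∈ Finset.range n, a k) / n) atTop (𝓝 (ENNReal.ofReal c)) := by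
  refine (ENNReal.tendsto_ofReal h).congr' ?_
  filter_upwards [eventually_gt_atTop 0] with n hn
  rw [ENNReal.ofReal_div_of_pos (by exact_mod_cast hn), ENNReal.ofReal_natCast,
    ← ENNReal.toReal_sum fun k _ => ha k, ENNReal.ofReal_toReal]
  exact ENNReal.sum_ne_top.2 fun k _ => ha k

lemma IsTwoSidedExtension.ae_gk_ne_top (h : IsTwoSidedExtension P Q) (hreg : IsRegular lam)
    (hsc : Continuous s) (hs : IsOptimalMap lam s) : ∀ᵐ ω ∂Q, ∀ k, gk lam Q s k ω ≠ ∞ := by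
  rw [ae_all_iff]
  intro k
  filter_upwards [ae_lt_top (hreg.measurable_gk (Q := Q) hsc k) (by
    rw [h.lintegral_gk hreg hsc]
    exact lintegral_optStrategy_ne_top hreg hs k)] with ω hω using hω.ne

lemma IsTwoSidedExtension.ae_gLim_ne_top (h : IsTwoSidedExtension P Q) (hreg : IsRegular lam)
    (hsc : Continuous s) (hs : IsOptimalMap lam s) : ∀ᵐ ω ∂Q, gLim lam Q s ω ≠ ∞ := by
  filter_upwards [ae_lt_top (hreg.measurable_gLim (Q := Q) hsc)
    (h.lintegral_gLim_ne_top hreg hsc hs)] with ω hω using hω.ne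

lemma ae_gSup_one_ne_top [IsFiniteMeasure Q] (hreg : IsRegular lam) (hsc : Continuous s)
    (hui : UnifIntegrableSeq Q (gSup lam Q s)) : ∀ᵐ ω ∂Q, gSup lam Q s 1 ω ≠ ∞ := by
  have hm := hreg.measurable_gSup (Q := Q) hsc 1
  filter_upwards [ae_lt_top hm (hui.lintegral_ne_top le_rfl hm)] with ω hω using hω.ne

lemma integrable_gSup [IsFiniteMeasure Q] (hreg : IsRegular lam) (hsc : Continuous s)
    (hui : UnifIntegrableSeq Q (gSup lam Q s)) {N : ℕ} (hN : 1 ≤ N) :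
    Integrable (fun ω => (gSup lam Q s N ω).toReal) Q := by
  have hm := hreg.measurable_gSup (Q := Q) hsc N
  exact integrable_toReal_of_lintegral_ne_top hm.aemeasurable (hui.lintegral_ne_top hN hm)

lemma IsTwoSidedExtension.integrable_gLim (h : IsTwoSidedExtension P Q) (hreg : IsRegular lam)
    (hsc : Continuous s) (hs : IsOptimalMap lam s) :
    Integrable (fun ω => (gLim lam Q s ω).toReal) Q :=
  integrable_toReal_of_lintegral_ne_top (hreg.measurable_gLim hsc).aemeasurable
    (h.lintegral_gLim_ne_top hreg hsc hs)

lemma IsTwoSidedExtension.ae_abs_gk_sub_gLim_le (h : IsTwoSidedExtension P Q)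
    (hreg : IsRegular lam) (hsc : Continuous s) (hs : IsOptimalMap lam s)
    (hui : UnifIntegrableSeq Q (gSup lam Q s)) :
    ∀ᵐ ω ∂Q, ∀ N ≥ 1, ∀ k ≥ N,
      |(gk lam Q s k ω).toReal - (gLim lam Q s ω).toReal| ≤ (gSup lam Q s N ω).toReal := by
  have := h.isProbabilityMeasure
  filter_upwards [h.ae_gk_ne_top hreg hsc hs, h.ae_gLim_ne_top hreg hsc hs,
    ae_gSup_one_ne_top hreg hsc hui] with ω h1 h2 h3 N hN k hk
  refine abs_toReal_sub_le (h1 k) h2 (ne_top_of_le_ne_top h3 (gSup_antitone ω hN)) ?_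
  exact le_iSup₂ (f := fun k (_ : k ≥ N) => (gk lam Q s k ω - gLim lam Q s ω) +
    (gLim lam Q s ω - gk lam Q s k ω)) k hk

/-! ### Convergence of the entropies and of the average losses -/

theorem IsTwoSidedExtension.ae_tendsto_sum_gk (hP : Ergodic shift P)
    (h : IsTwoSidedExtension P Q) (hreg : IsRegular lam) (hsc : Continuous s)
    (hs : IsOptimalMap lam s) (hui : UnifIntegrableSeq Q (gSup lam Q s)) :
    ∀ᵐ ω ∂Q, Tendsto
      (fun n : ℕ => (∑ k ∈ Finset.range n, (gk lam Q s k (shiftZ^[k] ω)).toReal) / n) atTop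
      (𝓝 (∫ ω, (gLim lam Q s ω).toReal ∂Q)) := by
  have := h.isProbabilityMeasure
  refine tendsto_sum_iterate_div (h.ergodic hP) (u := fun k ω => (gk lam Q s k ω).toReal)
    (G := fun N ω => (gSup lam Q s N ω).toReal) (hreg.measurable_gLim hsc).ennreal_toReal
    (h.integrable_gLim hreg hsc hs) (fun N => (hreg.measurable_gSup hsc N).ennreal_toReal)
    (fun N hN => integrable_gSup hreg hsc hui hN) ?_ ?_
    (h.ae_abs_gk_sub_gLim_le hreg hsc hs hui)
  · intro N hN
    filter_upwards [ae_gSup_one_ne_top hreg hsc hui] with ω hω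
    rw [Real.norm_of_nonneg ENNReal.toReal_nonneg]
    exact ENNReal.toReal_mono hω (gSup_antitone ω hN)
  · filter_upwards [h.ae_gLim_ne_top hreg hsc hs, hreg.ae_tendsto_gk (Q := Q) hsc] with ω h1 h2
    exact (ENNReal.tendsto_toReal ENNReal.zero_ne_top).comp (tendsto_gSup h1 h2)

theorem IsTwoSidedExtension.tendsto_stepEntropy_div (h : IsTwoSidedExtension P Q)
    (hreg : IsRegular lam) (hsc : Continuous s) (hs : IsOptimalMap lam s)
    (hui : UnifIntegrableSeq Q (gSup lam Q s)) :
    Tendsto (fun n : ℕ => stepEntropy lam P n / n) atTop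
      (𝓝 (ENNReal.ofReal (∫ ω, (gLim lam Q s ω).toReal ∂Q))) := by
  have := h.isProbabilityMeasure
  simp_rw [stepEntropy_eq_sum hs]
  refine tendsto_sum_div_of_toReal (fun k => lintegral_optStrategy_ne_top hreg hs k) ?_
  have hterm : ∀ k, (∫⁻ ω, lam (ω k) (optStrategy P s k (pre k ω)) ∂P).toReal =
      ∫ ω, (gk lam Q s k ω).toReal ∂Q := by
    intro k
    rw [← h.lintegral_gk hreg hsc, integral_toReal (hreg.measurable_gk hsc k).aemeasurable]
    filter_upwards [h.ae_gk_ne_top hreg hsc hs] with ω hω using (hω k).lt_top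
  simp_rw [hterm, div_eq_inv_mul]
  refine Tendsto.cesaro ?_
  -- For `k ≥ 1`, `g_k` is at most `g + G_1`; the term `k = 0` is not covered by `G_1` and does not
  -- affect the limit.
  refine tendsto_integral_filter_of_dominated_convergence
    (fun ω => (gLim lam Q s ω).toReal + (gSup lam Q s 1 ω).toReal)
    (Eventually.of_forall fun k =>
      (hreg.measurable_gk hsc k).ennreal_toReal.aestronglyMeasurable)
    ?_ ((h.integrable_gLim hreg hsc hs).add (integrable_gSup hreg hsc hui le_rfl)) ?_
  · filter_upwards [eventually_ge_atTop 1] with k hk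
    filter_upwards [h.ae_abs_gk_sub_gLim_le hreg hsc hs hui] with ω hω
    rw [Real.norm_of_nonneg ENNReal.toReal_nonneg]
    linarith [le_abs_self ((gk lam Q s k ω).toReal - (gLim lam Q s ω).toReal), hω 1 le_rfl k hk]
  · filter_upwards [h.ae_gLim_ne_top hreg hsc hs, hreg.ae_tendsto_gk (Q := Q) hsc] with ω h1 h2
    exact (ENNReal.tendsto_toReal h1).comp h2

/-- The average loss of the optimal strategy converges almost surely. -/
theorem IsTwoSidedExtension.ae_tendsto_loss_optStrategy_div (hP : Ergodic shift P)
    (h : IsTwoSidedExtension P Q) (hreg : IsRegular lam) (hsc : Continuous s)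
    (hs : IsOptimalMap lam s) (hui : UnifIntegrableSeq Q (gSup lam Q s)) :
    ∀ᵐ ω ∂P, Tendsto (fun n : ℕ => loss lam (pre n ω) (optStrategy P s) / n) atTop
      (𝓝 (ENNReal.ofReal (∫ ω, (gLim lam Q s ω).toReal ∂Q))) := by
  have hm : ∀ n : ℕ, Measurable fun ω => loss lam (pre n ω) (optStrategy P s) / (n : ℝ≥0∞) :=
    fun n => ((measurable_of_countable fun w : Fin n → Bool =>
      loss lam w (optStrategy P s)).comp (measurable_pre n)).div_const _
  suffices hQ : ∀ᵐ ω ∂Q, Tendsto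
      (fun n : ℕ => loss lam (pre n (restrictNat ω)) (optStrategy P s) / n) atTop
      (𝓝 (ENNReal.ofReal (∫ ω, (gLim lam Q s ω).toReal ∂Q))) by
    have hmap := (ae_map_iff h.restrict.aemeasurable
      (measurableSet_tendsto (l := atTop) (𝓝 _) hm)).2 hQ
    rwa [h.restrict.map_eq] at hmap
  -- The sum evaluates `g_k` at shifted points, so finiteness is needed along the whole orbit.
  have hiter : ∀ᵐ ω ∂Q, ∀ j k, gk lam Q s k (shiftZ^[j] ω) ≠ ∞ :=
    ae_all_iff.2 fun j => (h.invariant.iterate j).quasiMeasurePreserving.ae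
      (h.ae_gk_ne_top hreg hsc hs)
  filter_upwards [h.ae_tendsto_sum_gk hP hreg hsc hs hui, hiter,
    ae_all_iff.2 (h.ae_gk_shiftZ_iterate lam s)] with ω h1 h2 h3
  refine (tendsto_sum_div_of_toReal (fun k => h2 k k) h1).congr fun n => ?_
  rw [loss_pre]
  simp_rw [h3]

end PredictionGame

theorem theorem5p3 (lam : Bool → unitInterval → ENNReal)
    (P : MeasureTheory.Measure (ℕ → Bool)) [MeasureTheory.IsProbabilityMeasure P]
    (hP : Ergodic PredictionGame.shift P)
    (hG : PredictionGame.IsStronglyRegular lam P)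
    (S : ℕ → PredictionGame.Strategy)
    (hS : ∀ n : ℕ, PredictionGame.expectedLoss lam P n (S n) =
      PredictionGame.stepEntropy lam P n) :
    PredictionGame.entropy lam P ≠ ⊤ ∧
    Filter.Tendsto (fun n : ℕ => PredictionGame.stepEntropy lam P n / n) Filter.atTop
      (nhds (PredictionGame.entropy lam P)) ∧
    ∀ᵐ ω ∂P, Filter.Tendsto
      (fun n : ℕ => PredictionGame.loss lam (PredictionGame.pre n ω) (S n) / n) Filter.atTop
      (nhds (PredictionGame.entropy lam P)) := by
  obtain ⟨hreg, s, hsc, hs, hui⟩ := hG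
  have hE := PredictionGame.isTwoSidedExtension_twoSided P hP.toMeasurePreserving
  have hlim := hE.tendsto_stepEntropy_div hreg hsc hs hui
  have hH : PredictionGame.entropy lam P = _ := hlim.limUnder_eq
  rw [hH]
  refine ⟨ENNReal.ofReal_ne_top, hlim, ?_⟩
  -- The strategies may vary with `n`: the exceptional null sets are countably many, so almost
  -- surely every `S n` has the canonical loss on its own prefix.
  filter_upwards [hE.ae_tendsto_loss_optStrategy_div hP hreg hsc hs hui,
    ae_all_iff.2 fun n => hreg.ae_loss_eq_optStrategy hsc hs (hS n)] with ω h1 h2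
  simp_rw [h2]
  exact h1
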